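/- Conventions. A language is computable if its symbols are natural numbers, its sets of function symbols and of relation symbols are computable, and arities are computable. A computable $\Sigma_1$ formula $\varphi(\bar x)$ is a computably enumerable disjunction of formulas $\exists \bar y\,\theta(\bar x,\bar y)$ with $\theta$ finitary and quantifier-free. A generalized computable $\Sigma_1$ formula $\Phi(\bar x_1,\dots,\bar x_k)$ in $k$ tuple variables of arbitrary finite lengths is a family of computable $\Sigma_1$ formulas $\varphi_{n_1,\dots,n_k}$, computable uniformly in the lengths $(n_1,\dots,n_k)$; tuples $\bar a_1,\dots,\bar a_k\in\mathcal B^{<\omega}$ satisfy $\Phi$ in $\mathcal B$ if they satisfy $\varphi_{|\bar a_1|,\dots,|\bar a_k|}$. The orbit of a tuple is its orbit under $\mathrm{Aut}(\mathcal B)$. Let $\mathcal A$ be a structure for a computable relational language with basic relations $R_i$ of arity $k_i$, and let $\mathcal B$ be a structure for a computable language. $\mathcal A$ is effectively defined in $\mathcal B$ with parameters $\bar b$ if there are $D(\bar b)\subseteq\mathcal B^{<\omega}$ and complementary relations $R_i(\bar b),\neg R_i(\bar b)$ on $D(\bar b)$ (of arity $k_i$) with $(D(\bar b),(R_i(\bar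 b))_i)\cong\mathcal A$, all defined by a uniformly computable sequence of generalized computable $\Sigma_1$ formulas with parameters $\bar b$. $\mathcal A$ is effectively interpreted in $\mathcal B$ without parameters if there are $D\subseteq\mathcal B^{<\omega}$, an equivalence relation $\sim$ on $D$ and $\sim$-invariant relations $R_i^*$ on $D$ with $(D,(R_i^*)_i)/{\sim}\cong\mathcal A$, such that $D$, $\sim$, $\not\sim$ and all $R_i^*$, $\neg R_i^*$ (complements taken in powers of $D$) are defined by a computable sequence of generalized computable $\Sigma_1$ formulas without parameters. Proposition. Suppose $\mathcal A$ is effectively defined in $\mathcal B$ with parameters $\bar b$. For $\bar c$ in the orbit of $\bar b$, let $\mathcal A_{\bar c}$ be the copy of $\mathcal A$ defined by the same formulas with parameters $\bar c$ replacing $\bar b$. Suppose that 1. the orbit of $\bar b$ is defined by a computable $\Sigma_1$ formula $\varphi(\bar u)$; 2. there is a generalized computable $\Sigma_1$ formula $\psi(\bar u,\bar v,\bar x,\bar y)$ such that for all $\bar c,\bar d$ in the orbit of $\bar b$, the formula $\psi(\bar c,\bar d,\bar x,\bar y)$ defines (the graph of) an isomorphism $f_{\bar c,\bar d}$ from $\mathcal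 A_{\bar c}$ onto $\mathcal A_{\bar d}$; 3. this family preserves identity and composition: $f_{\bar c,\bar c}=\mathrm{id}$ and $f_{\bar d,\bar e}\circ f_{\bar c,\bar d}=f_{\bar c,\bar e}$ for all $\bar c,\bar d,\bar e$ in the orbit of $\bar b$. Then $\mathcal A$ is effectively interpreted in $\mathcal B$ without parameters. -/

import Mathlib

open FirstOrder

/-- A computable language: its symbols are identified with natural numbers in such a way that the
sets of function symbols and of relation symbols are computable and the arity of a symbol is
computable from its number. -/
class ComputableLanguage (L : Language) where
  funCode : (Σ n, L.Functions n) → ℕ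
  relCode : (Σ n, L.Relations n) → ℕ
  funCode_injective : Function.Injective funCode
  relCode_injective : Function.Injective relCode
  computable_fun : ComputablePred fun s : ℕ => s ∈ Set.range funCode
  computable_rel : ComputablePred fun s : ℕ => s ∈ Set.range relCode
  computable_funArity : ∃ a : ℕ → ℕ, Computable a ∧ ∀ f, a (funCode f) = f.1
  computable_relArity : ∃ a : ℕ → ℕ, Computable a ∧ ∀ R, a (relCode R) = R.1

/-- The set `B^{<ω}` of all finite tuples from `B` (including the empty tuple). -/
abbrev Tuple (B : Type*) := Σ n : ℕ, (Fin n → B)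

/-- The variables of a formula in `k` tuple variables, the `p`-th of which has length `n p`:
`⟨p, q⟩` is the `q`-th entry of the `p`-th tuple. -/
abbrev TupleVar {k : ℕ} (n : Fin k → ℕ) := Σ p : Fin k, Fin (n p)

/-! ### Gödel numbering of finitary formulas (Polish notation) -/

/-- The letters of the alphabet in which formulas are written; the first component is the kind. -/
abbrev Token := ℕ × ℕ × ℕ

/-- The `q`-th entry of the `p`-th free tuple variable. -/
def Token.free (p q : ℕ) : Token := (0, p, q)

/-- The `r`-th bound variable. -/
def Token.bound (r : ℕ) : Token := (1, r, 0)

/-- The function symbol with number `s`. -/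
def Token.func (s : ℕ) : Token := (2, s, 0)

/-- The relation symbol with number `s`. -/
def Token.rel (s : ℕ) : Token := (3, s, 0)

/-- The logical symbols `⊥`, `=`, `→`, `∀`, numbered `0`, `1`, `2`, `3`. -/
def Token.logic (s : ℕ) : Token := (4, s, 0)

section Coding

variable {L : Language} [ComputableLanguage L] {k : ℕ} {n : Fin k → ℕ}

/-- The letter for a variable or function symbol. -/
def termToken {m : ℕ} : (TupleVar n ⊕ Fin m) ⊕ (Σ i, L.Functions i) → Token
  | Sum.inl (Sum.inl v) => Token.free v.1 v.2
  | Sum.inl (Sum.inr r) => Token.bound r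
  | Sum.inr f => Token.func (ComputableLanguage.funCode f)

/-- A term in Polish notation. -/
def termCode {m : ℕ} (t : L.Term (TupleVar n ⊕ Fin m)) : List Token :=
  t.listEncode.map termToken

/-- A finitary formula in Polish notation. -/
def formulaCode : {m : ℕ} → L.BoundedFormula (TupleVar n) m → List Token
  | _, .falsum => [Token.logic 0]
  | _, .equal t₁ t₂ => Token.logic 1 :: (termCode t₁ ++ termCode t₂)
  | _, .rel (l := l) R ts =>
      Token.rel (ComputableLanguage.relCode ⟨l, R⟩) ::
        (List.ofFn fun p => termCode (ts p)).flatten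
  | _, .imp θ₁ θ₂ => Token.logic 2 :: (formulaCode θ₁ ++ formulaCode θ₂)
  | _, .all θ => Token.logic 3 :: formulaCode θ

end Coding

/-! ### Computable `Σ₁` formulas -/

/-- A disjunct `∃ y₀ … y_{m-1} θ` with `θ` finitary and quantifier-free; the free variables are
indexed by `α`. -/
abbrev Disjunct (L : Language) (α : Type*) :=
  Σ m : ℕ, {θ : L.BoundedFormula α m // θ.IsQF}

/-- A countable disjunction of disjuncts `∃ y₀ … y_{m-1} θ`, presented as a list
(the value `none` contributes no disjunct). -/
abbrev SigmaOne (L : Language) (α : Type*) := ℕ → Option (Disjunct L α)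

/-- Satisfaction of a `Σ₁` formula under an assignment of its free variables. -/
def SigmaOne.Realize {L : Language} {α : Type*} {M : Type*} [L.Structure M]
    (φ : SigmaOne L α) (v : α → M) : Prop :=
  ∃ j, ∃ d ∈ φ j, ∃ y : Fin d.1 → M, d.2.1.Realize v y

/-- The list of the codes of the disjuncts of a `Σ₁` formula. -/
def SigmaOne.codes {L : Language} [ComputableLanguage L] {k : ℕ} {n : Fin k → ℕ}
    (φ : SigmaOne L (TupleVar n)) (j : ℕ) : Option (ℕ × List Token) :=
  (φ j).map fun d => (d.1, formulaCode d.2.1)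

/-- A computable `Σ₁` formula: the disjuncts are computably enumerated. -/
def SigmaOne.IsComputable {L : Language} [ComputableLanguage L] {k : ℕ} {n : Fin k → ℕ}
    (φ : SigmaOne L (TupleVar n)) : Prop :=
  Computable φ.codes

/-- A generalized `Σ₁` formula in `k` tuple variables: one `Σ₁` formula for each choice of the
lengths of the `k` tuples. -/
abbrev GenSigmaOne (L : Language) (k : ℕ) := (n : Fin k → ℕ) → SigmaOne L (TupleVar n)

/-- Satisfaction of a generalized `Σ₁` formula by `k` tuples: these satisfy the formula for their
lengths. -/
def GenSigmaOne.Holds {L : Language} {k : ℕ} {B : Type*} [L.Structure B]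
    (φ : GenSigmaOne L k) (xs : Fin k → Tuple B) : Prop :=
  (φ fun p => (xs p).1).Realize fun v => (xs v.1).2 v.2

/-- A (uniformly) computable sequence of generalized computable `Σ₁` formulas `Φ i`, where the
index `i` has the number `key i` and `Φ i` has `k i` tuple variables: from (the number of) `i` and
the lengths of the tuples one can compute an enumeration of the disjuncts. -/
def IsComputableSeq {L : Language} [ComputableLanguage L] {ι : Type*} (key : ι → ℕ) {k : ι → ℕ}
    (Φ : ∀ i, GenSigmaOne L (k i)) : Prop :=
  ∃ g : ℕ × List ℕ × ℕ → Option (ℕ × List Token), Computable g ∧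
    ∀ (i : ι) (n : Fin (k i) → ℕ) (j : ℕ), g (key i, List.ofFn n, j) = (Φ i n).codes j

/-- A generalized computable `Σ₁` formula. -/
def GenSigmaOne.IsComputable {L : Language} [ComputableLanguage L] {k : ℕ}
    (φ : GenSigmaOne L k) : Prop :=
  IsComputableSeq (fun _ : Unit => 0) fun _ : Unit => φ

/-! ### Effective definitions with parameters -/

/-- A uniformly computable sequence of generalized computable `Σ₁` formulas `D(u; x)` and
`± R(u; x₁, …, x_k)`, for the relation symbols `R` of `L'`.  The first tuple variable `u` is for
the parameters. -/
structure DefiningFormulas (L L' : Language) [ComputableLanguage L] [ComputableLanguage L'] where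
  dom : GenSigmaOne L 2
  pos : ∀ R : (Σ n, L'.Relations n), GenSigmaOne L (R.1 + 1)
  neg : ∀ R : (Σ n, L'.Relations n), GenSigmaOne L (R.1 + 1)
  dom_computable : dom.IsComputable
  pos_computable : IsComputableSeq ComputableLanguage.relCode pos
  neg_computable : IsComputableSeq ComputableLanguage.relCode neg

section Definitions

variable {L L' : Language} [ComputableLanguage L] [ComputableLanguage L']
  {B : Type*} [L.Structure B]

/-- The set `D(c)` defined with parameters `c`. -/
def DefiningFormulas.Domain (S : DefiningFormulas L L') (c : Tuple B) : Set (Tuple B) :=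
  {x | S.dom.Holds ![c, x]}

/-- The structure with universe `D(c)` and relations `R(c)` defined with parameters `c`. -/
instance DefiningFormulas.structure [L'.IsRelational] (S : DefiningFormulas L L') (c : Tuple B) :
    L'.Structure (S.Domain c) where
  funMap f _ := isEmptyElim f
  RelMap {k} R xs :=
    (S.pos ⟨k, R⟩).Holds (Fin.cons (α := fun _ => Tuple B) c fun p => (xs p : Tuple B))

/-- The formulas effectively define the structure `A` in `B` with parameters `b`: for each relation
symbol `R` of arity `k`, `R(b)` is a subset of `D(b)^k`, `¬ R(b)` is its complement in `D(b)^k`, and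
`D(b)` with the relations `R(b)` is a copy of `A`. -/
def DefiningFormulas.EffectivelyDefine [L'.IsRelational] (S : DefiningFormulas L L')
    (A : Type*) [L'.Structure A] (b : Tuple B) : Prop :=
  (∀ (R : Σ n, L'.Relations n) (xs : Fin R.1 → Tuple B),
    ((S.pos R).Holds (Fin.cons (α := fun _ => Tuple B) b xs) → ∀ p, xs p ∈ S.Domain b) ∧
    ((S.neg R).Holds (Fin.cons (α := fun _ => Tuple B) b xs) ↔
      (∀ p, xs p ∈ S.Domain b) ∧
        ¬ (S.pos R).Holds (Fin.cons (α := fun _ => Tuple B) b xs))) ∧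
  Nonempty (A ≃[L'] S.Domain b)

end Definitions

/-- The orbit of a tuple under the automorphisms of the structure. -/
def autOrbit (L : Language) {B : Type*} [L.Structure B] {l : ℕ} (b : Fin l → B) :
    Set (Fin l → B) :=
  {c | ∃ g : B ≃[L] B, c = fun p => g (b p)}

/-! ### Effective interpretations without parameters -/

/-- The relational structure `A` is effectively interpreted in `B` without parameters: there are a
set `D` of finite tuples from `B`, an equivalence relation `∼` on `D` and relations `R*` on `D`,
invariant under `∼`, such that the quotient of `(D, (R*))` by `∼` is isomorphic to `A` and `D`,
`± ∼`, `± R*` are defined by a computable sequence of generalized computable `Σ₁` formulas. -/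
def EffectivelyInterpreted (L L' : Language) [ComputableLanguage L] [ComputableLanguage L']
    (A : Type*) [L'.Structure A] (B : Type*) [L.Structure B] : Prop :=
  ∃ (D : Set (Tuple B)) (s : Setoid D) (_ : L'.Prestructure s),
    Nonempty (A ≃[L'] Quotient s) ∧
    (∃ dom : GenSigmaOne L 1, dom.IsComputable ∧ ∀ x : Tuple B, dom.Holds ![x] ↔ x ∈ D) ∧
    (∃ eqv : GenSigmaOne L 2, eqv.IsComputable ∧
      ∀ x y : Tuple B, eqv.Holds ![x, y] ↔ ∃ (hx : x ∈ D) (hy : y ∈ D), s ⟨x, hx⟩ ⟨y, hy⟩) ∧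
    (∃ neqv : GenSigmaOne L 2, neqv.IsComputable ∧
      ∀ x y : Tuple B, neqv.Holds ![x, y] ↔ ∃ (hx : x ∈ D) (hy : y ∈ D), ¬ s ⟨x, hx⟩ ⟨y, hy⟩) ∧
    (∃ pos : ∀ R : (Σ n, L'.Relations n), GenSigmaOne L R.1,
      IsComputableSeq ComputableLanguage.relCode pos ∧
      ∀ (R : Σ n, L'.Relations n) (xs : Fin R.1 → Tuple B),
        (pos R).Holds xs ↔ ∃ h : ∀ p, xs p ∈ D,
          (Language.Prestructure.toStructure s).RelMap R.2 fun p => (⟨xs p, h p⟩ : D)) ∧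
    (∃ neg : ∀ R : (Σ n, L'.Relations n), GenSigmaOne L R.1,
      IsComputableSeq ComputableLanguage.relCode neg ∧
      ∀ (R : Σ n, L'.Relations n) (xs : Fin R.1 → Tuple B),
        (neg R).Holds xs ↔ ∃ h : ∀ p, xs p ∈ D,
          ¬ (Language.Prestructure.toStructure s).RelMap R.2 fun p => (⟨xs p, h p⟩ : D))

/-! Absorb the parameters into the elements. The new domain consists of the concatenations of a
tuple `c` in the orbit of `b` with a tuple `x` in `D(c)`; since `c` has the fixed length `l`, it can
be read off. Identify `c⌢x` with `d⌢y` when `f c d x = y`. The map `F (c⌢x) = f c b x` onto `D(b)`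
shows that this works. Coherence of the family gives `F (c⌢x) = F (d⌢y)` iff `f c d x = y` (`hiso`),
so the identification is the kernel of `F`; `f b b = id` makes `F` surjective. Pulling the relations
back along `F` makes the quotient a copy of `D(b)`, hence of `A`. `F` mentions `b`, but the
definitions need not. Inequivalence is `Σ₁` because `f c d` is total: its value at `x` exists and
differs from `y`. A relation or its complement is tested by moving all arguments to one
existentially quantified `u` in the orbit and using the given formulas with parameters `u`; by
automorphism invariance these are still complementary (`of_mem_autOrbit`). The remaining work is
effectivity. A conjunction of generalized `Σ₁` formulas, prefixed by quantifiers over tuples of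
unbounded length, is a disjunction over all lengths, all ways of splitting the bound variables into
tuples, and all choices of one disjunct per conjunct (`realize_conjFormula`). On codes this is an
algorithm that rewrites and concatenates words (`assembleCode_eq`, `isComputableSeq_conjFormula`).
-/

/-! ### Substitution of variables in quantifier-free formulas -/

section Substitution

variable {L : Language} {α β : Type*}

/-- Substitution of variables, free or bound, in a quantifier-free formula
(a formula that starts with a quantifier is sent to `⊥`). -/
def substQF {m N : ℕ} (σ : α ⊕ Fin m → β ⊕ Fin N) :
    L.BoundedFormula α m → L.BoundedFormula β N
  | .falsum => .falsum
  | .equal t₁ t₂ => .equal (t₁.relabel σ) (t₂.relabel σ)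
  | .rel R ts => .rel R fun p => (ts p).relabel σ
  | .imp θ₁ θ₂ => .imp (substQF σ θ₁) (substQF σ θ₂)
  | .all _ => .falsum

theorem isQF_substQF {m N : ℕ} (σ : α ⊕ Fin m → β ⊕ Fin N) {θ : L.BoundedFormula α m}
    (h : θ.IsQF) : (substQF σ θ).IsQF := by
  induction h with
  | falsum => exact .falsum
  | of_isAtomic h =>
    cases h with
    | equal t₁ t₂ => exact .of_isAtomic (.equal _ _)
    | rel R ts => exact .of_isAtomic (.rel _ _)
  | imp _ _ h₁ h₂ => exact .imp h₁ h₂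

theorem realize_substQF {M : Type*} [L.Structure M] {m N : ℕ} (σ : α ⊕ Fin m → β ⊕ Fin N)
    {θ : L.BoundedFormula α m} (h : θ.IsQF) (v : β → M) (y : Fin N → M)
    (v' : α → M) (y' : Fin m → M) (hv : Sum.elim v y ∘ σ = Sum.elim v' y') :
    (substQF σ θ).Realize v y ↔ θ.Realize v' y' := by
  induction h with
  | falsum => exact Iff.rfl
  | of_isAtomic h =>
    cases h with
    | equal t₁ t₂ =>
      simp only [Language.Term.bdEqual, substQF, Language.BoundedFormula.Realize,
        Language.Term.realize_relabel, hv]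
    | rel R ts =>
      simp only [Language.Relations.boundedFormula, substQF, Language.BoundedFormula.Realize,
        Language.Term.realize_relabel, hv]
  | imp _ _ h₁ h₂ =>
    simp only [substQF, Language.BoundedFormula.realize_imp, h₁, h₂]

theorem listEncode_relabel (g : α → β) (t : L.Term α) :
    (t.relabel g).listEncode = t.listEncode.map (Sum.map g id) := by
  induction t with
  | var => rfl
  | func f ts ih =>
    simp only [Language.Term.relabel, Language.Term.listEncode, List.map_cons, Sum.map_inr, id,
      List.map_flatMap, ih]

end Substitution

section SubstitutionCode

variable {L : Language} [ComputableLanguage L] {k k' : ℕ} {n : Fin k → ℕ} {n' : Fin k' → ℕ}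

theorem termCode_relabel {m N : ℕ} (σ : TupleVar n ⊕ Fin m → TupleVar n' ⊕ Fin N)
    (τ : Token → Token) (hτ : ∀ x, τ (termToken (L := L) (.inl x)) = termToken (L := L) (.inl (σ x)))
    (hτ' : ∀ s, τ (Token.func s) = Token.func s) (t : L.Term (TupleVar n ⊕ Fin m)) :
    termCode (t.relabel σ) = (termCode t).map τ := by
  simp only [termCode, listEncode_relabel, List.map_map]
  congr 1
  funext x
  rcases x with x | f
  · exact (hτ x).symm
  · exact (hτ' _).symm

/-- With no quantifiers there is nothing to capture, and in Polish notation a variable is a single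
letter; so substitution acts letter by letter and the symbols, of kind at least 2, stay fixed. -/
theorem formulaCode_substQF {m N : ℕ} (σ : TupleVar n ⊕ Fin m → TupleVar n' ⊕ Fin N)
    (τ : Token → Token) (hτ : ∀ x, τ (termToken (L := L) (.inl x)) = termToken (L := L) (.inl (σ x)))
    (hτ' : ∀ t : Token, 2 ≤ t.1 → τ t = t) {θ : L.BoundedFormula (TupleVar n) m} (h : θ.IsQF) :
    formulaCode (substQF σ θ) = (formulaCode θ).map τ := by
  have hf : ∀ s, τ (Token.func s) = Token.func s := fun s => hτ' _ le_rfl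
  induction h with
  | falsum => simp [substQF, formulaCode, hτ' (Token.logic 0) (by simp [Token.logic])]
  | of_isAtomic h =>
    cases h with
    | equal t₁ t₂ =>
      simp [Language.Term.bdEqual, substQF, formulaCode, termCode_relabel σ τ hτ hf,
        hτ' (Token.logic 1) (by simp [Token.logic])]
    | rel R ts =>
      simp only [Language.Relations.boundedFormula, substQF, formulaCode,
        termCode_relabel σ τ hτ hf, List.map_cons, List.map_flatten, List.map_ofFn]
      rw [hτ' _ (by simp [Token.rel])]
      rfl
  | imp _ _ h₁ h₂ =>
    simp [substQF, formulaCode, h₁, h₂, hτ' (Token.logic 2) (by simp [Token.logic])]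

end SubstitutionCode

/-! ### Conjunctions of generalized `Σ₁` formulas -/

/-- A list regarded as a finite tuple. -/
def tupleOf {B : Type*} (xs : List B) : Tuple B := ⟨xs.length, xs.get⟩

/-- An atomic expression: the name `i` of a generalized `Σ₁` formula in `k i` tuple variables,
applied to `k i` lists of variables. -/
structure Atom {ι : Type*} (k : ι → ℕ) (V : Type*) where
  idx : ι
  args : Fin (k idx) → List V

section Conjunction

variable {L : Language} {ι : Type*} {k : ι → ℕ} (Φ : ∀ i, GenSigmaOne L (k i))

/-- The lengths of the argument tuples. -/
def Atom.len {V : Type*} (a : Atom k V) : Fin (k a.idx) → ℕ := fun p => (a.args p).length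

/-- Satisfaction of an atomic expression under an assignment of the variables. -/
def Atom.Holds {V B : Type*} [L.Structure B] (a : Atom k V) (v : V → B) : Prop :=
  (Φ a.idx).Holds fun p => tupleOf ((a.args p).map v)

theorem tupleOf_eq_iff {B : Type*} (xs : List B) (x : Tuple B) :
    tupleOf xs = x ↔ xs = List.ofFn x.2 :=
  (List.equivSigmaTuple (α := B)).eq_symm_apply.symm

/-- Satisfaction of the `j`-th disjunct of an atomic expression. -/
def Atom.HoldsAt {V B : Type*} [L.Structure B] (a : Atom k V) (v : V → B) (j : ℕ) : Prop :=
  ∃ d ∈ Φ a.idx a.len j, ∃ y : Fin d.1 → B,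
    d.2.1.Realize (fun x => v ((a.args x.1).get x.2)) y

theorem GenSigmaOne.holds_congr {k : ℕ} (φ : GenSigmaOne L k) {B : Type*} [L.Structure B]
    (n : Fin k → ℕ) (v : TupleVar n → B) (xs : Fin k → Tuple B)
    (h : ∀ p, xs p = ⟨n p, fun q => v ⟨p, q⟩⟩) : φ.Holds xs ↔ (φ n).Realize v := by
  obtain rfl : xs = fun p => ⟨n p, fun q => v ⟨p, q⟩⟩ := funext h
  rfl

theorem Atom.holds_iff {V B : Type*} [L.Structure B] (a : Atom k V) (v : V → B) :
    a.Holds Φ v ↔ ∃ j, a.HoldsAt Φ v j := by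
  refine (GenSigmaOne.holds_congr (Φ a.idx) a.len
    (fun x => v ((a.args x.1).get x.2)) _ fun p => ?_).trans Iff.rfl
  exact (tupleOf_eq_iff _ _).2 (List.ext_get (by simp [Atom.len]) fun q _ _ => by simp; rfl)

variable {k₀ : ℕ} {n : Fin k₀ → ℕ} {M : ℕ}

/-- A quantifier-free formula with `M` distinguished bound variables and some further ones. -/
abbrev QFMatrix (L : Language) {k₀ : ℕ} (n : Fin k₀ → ℕ) (M : ℕ) :=
  Σ s : ℕ, {θ : L.BoundedFormula (TupleVar n) (M + s) // θ.IsQF}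

/-- Adding a conjunct, with its own bound variables, to a matrix. -/
def QFMatrix.add (D : QFMatrix L n M) {α : Type*} (d : Disjunct L α)
    (σ : α → TupleVar n ⊕ Fin M) : QFMatrix L n M :=
  ⟨D.1 + d.1,
    substQF (Sum.map id (Fin.castLE (by omega))) D.2.1 ⊓
      substQF (Sum.elim (fun x => Sum.map id (Fin.castLE (by omega)) (σ x))
        -- The bound variables of `d` go after the `M` shared ones and the `D.1` already in use, so
        -- that different conjuncts have disjoint private variables.
        fun r => Sum.inr ⟨M + D.1 + r, by omega⟩) d.2.1,
    -- `⊓` unfolds to `(θ₁ → (θ₂ → ⊥)) → ⊥`.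
    .imp (.imp (isQF_substQF _ D.2.2) (.imp (isQF_substQF _ d.2.2) .falsum)) .falsum⟩

/-- Satisfaction of a matrix under an assignment of the free and of the distinguished variables. -/
def QFMatrix.Holds {B : Type*} [L.Structure B] (D : QFMatrix L n M)
    (v : TupleVar n → B) (w : Fin M → B) : Prop :=
  ∃ y : Fin D.1 → B, D.2.1.Realize v (Fin.append w y)

/-- As the private variables are disjoint, witnesses for the conjunction are exactly concatenations
of witnesses for the two conjuncts. -/
theorem QFMatrix.holds_add {B : Type*} [L.Structure B] (D : QFMatrix L n M) {α : Type*}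
    (d : Disjunct L α) (σ : α → TupleVar n ⊕ Fin M) (v : TupleVar n → B) (w : Fin M → B) :
    (D.add d σ).Holds v w ↔
      D.Holds v w ∧ ∃ y : Fin d.1 → B, d.2.1.Realize (Sum.elim v w ∘ σ) y := by
  have key : ∀ (y : Fin D.1 → B) (y' : Fin d.1 → B),
      (D.add d σ).2.1.Realize v (Fin.append w (Fin.append y y')) ↔
        D.2.1.Realize v (Fin.append w y) ∧ d.2.1.Realize (Sum.elim v w ∘ σ) y' := by
    intro y y'
    simp only [QFMatrix.add, Language.BoundedFormula.realize_inf]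
    refine and_congr (realize_substQF _ D.2.2 _ _ _ _ ?_) (realize_substQF _ d.2.2 _ _ _ _ ?_)
    · funext x
      rcases x with x | x
      · rfl
      · simp only [Function.comp, Sum.map_inr, Sum.elim_inr]
        refine Fin.addCases (fun p => ?_) (fun p => ?_) x
        · exact (Fin.append_left w (Fin.append y y') p).trans (Fin.append_left w y p).symm
        · exact ((Fin.append_right w (Fin.append y y') (Fin.castAdd _ p)).trans
            (Fin.append_left y y' p)).trans (Fin.append_right w y p).symm
    · funext x
      rcases x with x | x
      · simp only [Function.comp, Sum.elim_inl]
        rcases σ x with z | z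
        · rfl
        · simp only [Sum.map_inr, Sum.elim_inr]
          exact Fin.append_left w (Fin.append y y') z
      · simp only [Function.comp, Sum.elim_inr]
        have h : (⟨M + D.1 + x, by omega⟩ : Fin (M + (D.1 + d.1))) =
            Fin.natAdd M (Fin.natAdd D.1 x) := Fin.ext (Nat.add_assoc _ _ _)
        exact (congrArg _ h).trans ((Fin.append_right w (Fin.append y y') _).trans
          (Fin.append_right y y' x))
  constructor
  · rintro ⟨z, hz⟩
    obtain ⟨y, y', rfl⟩ : ∃ y y', z = Fin.append y y' :=
      ⟨fun p => z (Fin.castAdd _ p), fun p => z (Fin.natAdd _ p), (Fin.append_castAdd_natAdd).symm⟩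
    have := (key y y').1 hz
    exact ⟨⟨y, this.1⟩, y', this.2⟩
  · rintro ⟨⟨y, h⟩, y', h'⟩
    exact ⟨_, (key y y').2 ⟨h, h'⟩⟩

end Conjunction

section Assembly

variable {L : Language} {ι : Type*} {k : ι → ℕ} (Φ : ∀ i, GenSigmaOne L (k i))
  {k₀ : ℕ} {n : Fin k₀ → ℕ} {M : ℕ}

/-- The conjunction of one disjunct of each of the listed atomic expressions; `J` selects the
disjuncts. -/
def assemble (J : ℕ → ℕ) : List (Atom k (TupleVar n ⊕ Fin M)) → Option (QFMatrix L n M)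
  | [] => some ⟨0, .imp .falsum .falsum, .imp .falsum .falsum⟩
  | a :: as => (assemble J as).bind fun D =>
      -- Choices are indexed from the end of the list, so prepending an expression leaves the
      -- earlier choices in place.
      (Φ a.idx a.len (J as.length)).map fun d => D.add d fun x => (a.args x.1).get x.2

theorem assemble_congr {J J' : ℕ → ℕ} (as : List (Atom k (TupleVar n ⊕ Fin M)))
    (h : ∀ t < as.length, J t = J' t) : assemble Φ J as = assemble Φ J' as := by
  induction as with
  | nil => rfl
  | cons a as ih =>
    simp only [assemble]
    rw [ih fun t ht => h t (by simp; omega), h as.length (by simp)]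

theorem holds_assemble_cons {B : Type*} [L.Structure B] (J : ℕ → ℕ)
    (a : Atom k (TupleVar n ⊕ Fin M)) (as : List (Atom k (TupleVar n ⊕ Fin M)))
    (v : TupleVar n → B) (w : Fin M → B) :
    (∃ D ∈ assemble Φ J (a :: as), D.Holds v w) ↔
      (∃ D ∈ assemble Φ J as, D.Holds v w) ∧ a.HoldsAt Φ (Sum.elim v w) (J as.length) := by
  simp only [assemble, Option.mem_def, Option.bind_eq_some_iff, Option.map_eq_some_iff]
  constructor
  · rintro ⟨_, ⟨D, hD, d, hd, rfl⟩, h⟩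
    rw [QFMatrix.holds_add] at h
    exact ⟨⟨D, hD, h.1⟩, d, hd, h.2⟩
  · rintro ⟨⟨D, hD, h⟩, d, hd, h'⟩
    exact ⟨_, ⟨D, hD, d, hd, rfl⟩, (QFMatrix.holds_add D d _ v w).2 ⟨h, h'⟩⟩

/-- Conjunction distributes over the disjunctions: the choices for different conjuncts are
independent, since the tail reads `J` only below its own length and the value there can be updated
freely. -/
theorem holds_assemble {B : Type*} [L.Structure B] (as : List (Atom k (TupleVar n ⊕ Fin M)))
    (v : TupleVar n → B) (w : Fin M → B) :
    (∃ J, ∃ D ∈ assemble Φ J as, D.Holds v w) ↔ ∀ a ∈ as, a.Holds Φ (Sum.elim v w) := by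
  induction as with
  | nil =>
    simp only [List.not_mem_nil, false_implies, implies_true, iff_true]
    exact ⟨id, _, rfl, finZeroElim, fun h => h⟩
  | cons a as ih =>
    simp only [holds_assemble_cons, List.forall_mem_cons, Atom.holds_iff Φ a, ← ih]
    constructor
    · rintro ⟨J, h, h'⟩
      exact ⟨⟨_, h'⟩, J, h⟩
    · rintro ⟨⟨j, hj⟩, J, h⟩
      refine ⟨Function.update J as.length j, ?_, by simpa using hj⟩
      rwa [assemble_congr Φ as fun t ht => Function.update_of_ne ht.ne _ _]

/-- The entries below `M` of the `p`-th of the listed lists. -/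
def selectVars (M : ℕ) (e : List (List ℕ)) (p : ℕ) : List (Fin M) :=
  (e.getD p []).filterMap fun i => if h : i < M then some ⟨i, h⟩ else none

/-- This lets a disjunction over `M` and `e` replace quantifiers over tuples of arbitrary length:
every entry of every list gets its own bound variable. -/
theorem exists_selectVars {B : Type*} {K : ℕ} (t : Fin K → List B) :
    ∃ (M : ℕ) (e : List (List ℕ)) (w : Fin M → B), ∀ p : Fin K,
      (selectVars M e p).map w = t p := by
  let E := finSigmaFinEquiv (n := fun p => (t p).length)
  refine ⟨_, List.ofFn fun p : Fin K => List.ofFn fun q : Fin (t p).length => (E ⟨p, q⟩ : ℕ),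
    fun i => (t (E.symm i).1).get (E.symm i).2, fun p => ?_⟩
  have h : selectVars (∑ p, (t p).length)
      (List.ofFn fun p : Fin K => List.ofFn fun q : Fin (t p).length => (E ⟨p, q⟩ : ℕ)) p =
        List.ofFn fun q => E ⟨p, q⟩ := by
    have : (List.ofFn fun q : Fin (t p).length => (E ⟨p, q⟩ : ℕ)) =
        (List.ofFn fun q => E ⟨p, q⟩).map Fin.val := by
      rw [List.map_ofFn]; rfl
    simp only [selectVars, List.getD_eq_getElem?_getD, List.getElem?_ofFn, Fin.is_lt, dite_true,
      Option.getD_some, this, List.filterMap_map]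
    convert List.filterMap_some
    simp
  rw [h, List.map_ofFn]
  refine (congrArg List.ofFn (funext fun q => ?_)).trans (List.ofFn_get (t p))
  exact congrArg (fun z : TupleVar fun p => (t p).length => (t z.1).get z.2)
    (E.symm_apply_apply ⟨p, q⟩)

/-- The disjunct `∃ w₀ … w_{M-1} ⋀ as` with the number `(M, e, js)`, where `as` depends on a
sequence of tuples of the bound variables. -/
def conjDisjunct
    (as : ∀ M : ℕ, (ℕ → List (Fin M)) → List (Atom k (TupleVar n ⊕ Fin M)))
    (c : ℕ × List (List ℕ) × List ℕ) : Option (Disjunct L (TupleVar n)) :=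
  (assemble Φ (fun t => c.2.2.getD t 0) (as c.1 (selectVars c.1 c.2.1))).map fun D =>
    ⟨c.1 + D.1, D.2⟩

/-- The generalized `Σ₁` formula whose disjuncts are the formulas `∃ w₀ … w_{M-1} ⋀ as`. -/
def conjFormula
    (as : ∀ (n : Fin k₀ → ℕ) (M : ℕ), (ℕ → List (Fin M)) → List (Atom k (TupleVar n ⊕ Fin M))) :
    GenSigmaOne L k₀ := fun n j => conjDisjunct Φ (as n) (Denumerable.ofNat _ j)

/-- The index of a disjunct decodes to `(M, e, js)`. A finite list `js` can stand for the choice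
function, because only finitely many of its values are read. -/
theorem realize_conjFormula {B : Type*} [L.Structure B]
    (as : ∀ (n : Fin k₀ → ℕ) (M : ℕ), (ℕ → List (Fin M)) → List (Atom k (TupleVar n ⊕ Fin M)))
    (n : Fin k₀ → ℕ) (v : TupleVar n → B) :
    (conjFormula Φ as n).Realize v ↔ ∃ (M : ℕ) (e : List (List ℕ)) (w : Fin M → B),
      ∀ a ∈ as n M (selectVars M e), a.Holds Φ (Sum.elim v w) := by
  simp only [← holds_assemble]
  constructor
  · rintro ⟨j, d, hd, y, hy⟩
    simp only [conjFormula, conjDisjunct, Option.mem_def, Option.map_eq_some_iff] at hd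
    obtain ⟨D, hD, rfl⟩ := hd
    refine ⟨_, _, fun p => y (Fin.castAdd _ p), _, D, hD, fun p => y (Fin.natAdd _ p), ?_⟩
    rwa [Fin.append_castAdd_natAdd]
  · rintro ⟨M, e, w, J, D, hD, y, hy⟩
    let js := (List.range (as n M (selectVars M e)).length).map J
    refine ⟨Encodable.encode (M, e, js), ⟨M + D.1, D.2⟩, ?_, Fin.append w y, hy⟩
    refine (congrArg (conjDisjunct Φ (as n)) (Denumerable.ofNat_encode _)).trans ?_
    refine Option.map_eq_some_iff.2 ⟨D, ?_, rfl⟩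
    rw [← Option.mem_def.1 hD]
    refine assemble_congr Φ _ fun t ht => ?_
    simp [js, List.getD_eq_getElem?_getD, List.getElem?_map, List.getElem?_range ht]

end Assembly

/-! ### Conjunctions at the level of codes -/

section AssemblyCode

/-- Replacement of the free variables by the listed variables and of the `r`-th bound variable by
the `(N + r)`-th one. -/
def substToken (N : ℕ) (args : List (List Token)) (t : Token) : Token :=
  if t.1 = 0 then (args.getD t.2.1 []).getD t.2.2 (0, 0, 0)
  else if t.1 = 1 then Token.bound (N + t.2.1) else t

/-- The code of a conjunction whose second member is modified by a substitution. -/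
def andCode (c : List Token) (N : ℕ) (args : List (List Token)) (c' : List Token) : List Token :=
  Token.logic 2 :: Token.logic 2 :: (c ++ (Token.logic 2 ::
    (c'.map (substToken N args) ++ [Token.logic 0, Token.logic 0])))

/-- The effect of `assemble` on codes. -/
def assembleCode (g : ℕ × List ℕ × ℕ → Option (ℕ × List Token)) (M : ℕ) (js : List ℕ) :
    List (ℕ × List (List Token)) → Option (ℕ × List Token)
  | [] => some (M, [Token.logic 2, Token.logic 0, Token.logic 0])
  | a :: as => (assembleCode g M js as).bind fun D =>
      (g (a.1, a.2.map List.length, js.getD as.length 0)).map fun d =>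
        (D.1 + d.1, andCode D.2 D.1 a.2 d.2)

/-- The letter for a variable. -/
def varToken {k₀ : ℕ} {n : Fin k₀ → ℕ} {M : ℕ} : TupleVar n ⊕ Fin M → Token :=
  Sum.elim (fun x => Token.free x.1 x.2) fun r => Token.bound r

variable {L : Language} [ComputableLanguage L] {ι : Type*} (key : ι → ℕ) {k : ι → ℕ}
  (Φ : ∀ i, GenSigmaOne L (k i)) {k₀ : ℕ} {n : Fin k₀ → ℕ} {M : ℕ}

/-- The code of an atomic expression. -/
def Atom.code (a : Atom k (TupleVar n ⊕ Fin M)) : ℕ × List (List Token) :=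
  (key a.idx, List.ofFn fun p => (a.args p).map varToken)

/-- The code of `D` is unchanged, since enlarging the range of its bound variables keeps their
numbers; only the letters of `d` are rewritten. -/
theorem formulaCode_add (D : QFMatrix L n M) {k' : ℕ} {n' : Fin k' → ℕ}
    (d : Disjunct L (TupleVar n')) (args : Fin k' → List (TupleVar n ⊕ Fin M))
    (hargs : ∀ p, (args p).length = n' p) :
    formulaCode (D.add d fun x => (args x.1).get (x.2.cast (hargs x.1).symm)).2.1 =
      andCode (formulaCode D.2.1) (M + D.1) (List.ofFn fun p => (args p).map varToken)
        (formulaCode d.2.1) := by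
  have h₁ : ∀ s (σ : TupleVar n ⊕ Fin (M + D.1) → TupleVar n ⊕ Fin s),
      (∀ x, varToken (σ x) = varToken x) →
        formulaCode (substQF σ D.2.1) = formulaCode D.2.1 := by
    intro s σ hσ
    refine (formulaCode_substQF σ id (fun x => ?_) (fun _ _ => rfl) D.2.2).trans (List.map_id _)
    have := hσ x
    rcases x with x | x <;> rcases hx : σ _ with z | z <;> rw [hx] at this <;> exact this.symm
  have h₂ : ∀ s (σ : TupleVar n' ⊕ Fin d.1 → TupleVar n ⊕ Fin s),
      (∀ x, varToken (σ x) = substToken (M + D.1) (List.ofFn fun p => (args p).map varToken)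
        (varToken x)) →
        formulaCode (substQF σ d.2.1) = (formulaCode d.2.1).map
          (substToken (M + D.1) (List.ofFn fun p => (args p).map varToken)) := by
    intro s σ hσ
    refine formulaCode_substQF σ _ (fun x => ?_) (fun t ht => ?_) d.2.2
    · have := hσ x
      rcases x with x | x <;> rcases hx : σ _ with z | z <;> rw [hx] at this <;> exact this.symm
    · simp [substToken, show t.1 ≠ 0 by omega, show t.1 ≠ 1 by omega]
  have e : ∀ s (θ₁ θ₂ : L.BoundedFormula (TupleVar n) s),
      formulaCode (θ₁ ⊓ θ₂) = Token.logic 2 :: Token.logic 2 :: (formulaCode θ₁ ++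
        (Token.logic 2 :: (formulaCode θ₂ ++ [Token.logic 0, Token.logic 0]))) := by
    intro s θ₁ θ₂
    change formulaCode ((θ₁.imp (θ₂.imp .falsum)).imp .falsum) = _
    simp [formulaCode]
  simp only [QFMatrix.add, andCode]
  rw [e, h₁, h₂]
  · rintro (x | x)
    · have : ∀ z : TupleVar n ⊕ Fin M, ∀ s (h : M ≤ s),
          varToken (Sum.map id (Fin.castLE h) z) = varToken z := by
        rintro (z | z) s h <;> rfl
      simp only [Sum.elim_inl, this]
      simp [varToken, substToken, Token.free, List.getD_eq_getElem?_getD, hargs]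
    · simp [varToken, substToken, Token.bound]
  · rintro (x | x) <;> rfl

/-- Everything `assemble` needs is visible in the codes: `g` supplies the chosen disjuncts, and the
lengths of the arguments are the lengths of the words coding them. -/
theorem assembleCode_eq {g : ℕ × List ℕ × ℕ → Option (ℕ × List Token)}
    (hg : ∀ i (n : Fin (k i) → ℕ) j, g (key i, List.ofFn n, j) = (Φ i n).codes j)
    (js : List ℕ) (as : List (Atom k (TupleVar n ⊕ Fin M))) :
    assembleCode g M js (as.map (Atom.code key)) =
      (assemble Φ (fun t => js.getD t 0) as).map fun D => (M + D.1, formulaCode D.2.1) := by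
  induction as with
  | nil => rfl
  | cons a as ih =>
    have hl : (a.code key).2.map List.length = List.ofFn a.len := by
      simp only [Atom.code, List.map_ofFn]
      congr 1
      funext p
      simp [Atom.len]
    have h1 : (a.code key).1 = key a.idx := rfl
    simp only [List.map_cons, assembleCode, ih, assemble, hl, List.length_map, h1, hg,
      SigmaOne.codes, Option.map_bind, Option.bind_map]
    congr 1
    funext D
    simp only [Function.comp, Option.map_map]
    congr 1
    funext d
    refine Prod.ext (Nat.add_assoc _ _ _) ?_
    exact (formulaCode_add D d a.args fun p => rfl).symm

end AssemblyCode

/-! ### Computability of the assembled formulas -/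

section Computability

/-- Structural recursion on a list is a recursion on a counter that runs through the reversed list;
the step may be merely computable, as is needed when it calls the enumeration `g`. -/
theorem computable_list_rec {α β σ : Type*} [Primcodable α] [Primcodable β] [Primcodable σ]
    {F : α → List β → σ} {xs : α → List β} {init : α → σ} {step : α → β × ℕ × σ → σ}
    (hxs : Computable xs) (hinit : Computable init) (hstep : Computable₂ step)
    (h₀ : ∀ a, F a [] = init a) (h₁ : ∀ a b l, F a (b :: l) = step a (b, l.length, F a l)) :
    Computable fun a => F a (xs a) := by
  -- The default for an index out of range is harmless: the counter stays below the length.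
  let s : α → ℕ × σ → σ := fun a c =>
    Option.casesOn ((xs a).reverse[c.1]?) c.2 fun b => step a (b, c.1, c.2)
  have hs : Computable₂ s := by
    refine Computable.option_casesOn
      (Computable.list_getElem?.comp (Computable.list_reverse.comp (hxs.comp .fst))
        (Computable.fst.comp .snd)) (Computable.snd.comp .snd) ?_
    exact hstep.comp (Computable.fst.comp .fst)
      (Computable.snd.pair (Computable.snd.comp .fst))
  refine (Computable.nat_rec (Computable.list_length.comp hxs) hinit hs).of_eq fun a => ?_
  -- After `t` rounds the last `t` entries have been processed.
  have key : ∀ t ≤ (xs a).length,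
      (Nat.rec (init a) (fun t IH => s a (t, IH)) t : σ) = F a ((xs a).reverse.take t).reverse := by
    intro t ht
    induction t with
    | zero => simp [h₀]
    | succ t ih =>
      have hlt : t < (xs a).reverse.length := by simpa using ht
      rw [List.take_succ_eq_append_getElem hlt, List.reverse_append, List.reverse_singleton,
        List.singleton_append, h₁, ← ih (by omega), List.length_reverse, List.length_take_of_le hlt.le]
      simp only [s, List.getElem?_eq_getElem hlt]
  refine (key _ le_rfl).trans ?_
  rw [← List.length_reverse, List.take_length, List.reverse_reverse]

theorem primrec_substToken :
    Primrec fun c : (ℕ × List (List Token)) × Token => substToken c.1.1 c.1.2 c.2 := by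
  have h1 : Primrec fun c : (ℕ × List (List Token)) × Token => c.2.1 := Primrec.fst.comp .snd
  have h2 : Primrec fun c : (ℕ × List (List Token)) × Token => c.2.2.1 :=
    Primrec.fst.comp (Primrec.snd.comp .snd)
  have h3 : Primrec fun c : (ℕ × List (List Token)) × Token => c.2.2.2 :=
    Primrec.snd.comp (Primrec.snd.comp .snd)
  refine Primrec.ite (Primrec.eq.comp h1 (.const 0)) ?_
    (Primrec.ite (Primrec.eq.comp h1 (.const 1)) ?_ .snd)
  · exact (Primrec.list_getD _).comp
      ((Primrec.list_getD _).comp (Primrec.snd.comp .fst) h2) h3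
  · exact (Primrec.const 1).pair
      ((Primrec.nat_add.comp (Primrec.fst.comp .fst) h2).pair (.const 0))

theorem primrec_andCode {α : Type*} [Primcodable α] {c c' : α → List Token} {N : α → ℕ}
    {args : α → List (List Token)} (hc : Primrec c) (hN : Primrec N) (hargs : Primrec args)
    (hc' : Primrec c') : Primrec fun a => andCode (c a) (N a) (args a) (c' a) := by
  have h : Primrec fun a => (c' a).map (substToken (N a) (args a)) :=
    Primrec.list_map hc' (primrec_substToken.comp
      (((hN.comp .fst).pair (hargs.comp .fst)).pair .snd))
  exact Primrec.list_cons.comp (.const _) (Primrec.list_cons.comp (.const _)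
    (Primrec.list_append.comp hc (Primrec.list_cons.comp (.const _)
      (Primrec.list_append.comp h (.const _)))))

theorem computable_assembleCode {g : ℕ × List ℕ × ℕ → Option (ℕ × List Token)}
    (hg : Computable g) :
    Computable fun c : ℕ × List ℕ × List (ℕ × List (List Token)) =>
      assembleCode g c.1 c.2.1 c.2.2 := by
  refine computable_list_rec (F := fun c as => assembleCode g c.1 c.2.1 as)
    (xs := fun c : ℕ × List ℕ × List (ℕ × List (List Token)) => c.2.2)
    (init := fun c => some (c.1, [Token.logic 2, Token.logic 0, Token.logic 0]))
    (step := fun c x => x.2.2.bind fun D =>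
      (g (x.1.1, x.1.2.map List.length, c.2.1.getD x.2.1 0)).map fun d =>
        (D.1 + d.1, andCode D.2 D.1 x.1.2 d.2))
    (Computable.snd.comp .snd)
    (Computable.option_some.comp (Computable.fst.pair (.const _))) ?_ (fun _ => rfl)
    (fun _ _ _ => rfl)
  let γ := (((ℕ × List ℕ × List (ℕ × List (List Token))) ×
    (ℕ × List (List Token)) × ℕ × Option (ℕ × List Token)) × (ℕ × List Token))
  have hx : Primrec fun c : γ => c.1.2.1 := Primrec.fst.comp (Primrec.snd.comp .fst)
  have hj : Primrec fun c : γ => c.1.1.2.1.getD c.1.2.2.1 0 :=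
    (Primrec.list_getD 0).comp (Primrec.fst.comp (Primrec.snd.comp (Primrec.fst.comp .fst)))
      (Primrec.fst.comp (Primrec.snd.comp (Primrec.snd.comp .fst)))
  have hl : Primrec fun c : γ => c.1.2.1.2.map List.length :=
    Primrec.list_map (Primrec.snd.comp hx) (Primrec.list_length.comp .snd)
  have hg' : Computable fun c : γ =>
      g (c.1.2.1.1, c.1.2.1.2.map List.length, c.1.1.2.1.getD c.1.2.2.1 0) :=
    hg.comp ((Primrec.fst.comp hx).pair (hl.pair hj)).to_comp
  have hD : Primrec fun c : γ × (ℕ × List Token) => c.1.2 := Primrec.snd.comp .fst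
  have hd : Primrec fun c : γ × (ℕ × List Token) => c.2 := Primrec.snd
  have hc : Primrec fun c : γ × (ℕ × List Token) =>
      (c.1.2.1 + c.2.1, andCode c.1.2.2 c.1.2.1 c.1.1.2.1.2 c.2.2) :=
    (Primrec.nat_add.comp (Primrec.fst.comp hD) (Primrec.fst.comp hd)).pair
      (primrec_andCode (Primrec.snd.comp hD) (Primrec.fst.comp hD)
        (Primrec.snd.comp (hx.comp .fst)) (Primrec.snd.comp hd))
  exact Computable.option_bind (Computable.snd.comp (Computable.snd.comp .snd))
    (Computable.option_map hg' hc.to_comp)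

variable {L : Language} [ComputableLanguage L] {ι κ : Type*} (key : ι → ℕ) (key' : κ → ℕ)
  {k : ι → ℕ} (Φ : ∀ i, GenSigmaOne L (k i)) {k' : κ → ℕ}

/-- Decoding an index to `(M, e, js)`, listing the coded conjuncts by `h` and assembling them by
`assembleCode` enumerates the disjuncts uniformly. Hence only a primitive recursive description `h`
of the list of conjuncts has to be supplied. -/
theorem isComputableSeq_conjFormula (hΦ : IsComputableSeq key Φ)
    (as : ∀ (i : κ) (n : Fin (k' i) → ℕ) (M : ℕ), (ℕ → List (Fin M)) →
      List (Atom k (TupleVar n ⊕ Fin M)))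
    (h : ℕ × List ℕ × ℕ × List (List ℕ) → List (ℕ × List (List Token))) (hh : Primrec h)
    (has : ∀ i n M e, h (key' i, List.ofFn n, M, e) =
      (as i n M (selectVars M e)).map (Atom.code key)) :
    IsComputableSeq key' fun i => conjFormula Φ (as i) := by
  obtain ⟨g, hg, hgΦ⟩ := hΦ
  obtain ⟨dec, hdec, hdec'⟩ : ∃ dec : ℕ → ℕ × List (List ℕ) × List ℕ,
      Primrec dec ∧ dec = Denumerable.ofNat _ := ⟨_, Primrec.ofNat _, rfl⟩
  refine ⟨fun x => assembleCode g (dec x.2.2).1 (dec x.2.2).2.2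
    (h (x.1, x.2.1, (dec x.2.2).1, (dec x.2.2).2.1)), ?_, fun i n j => ?_⟩
  · have hc : Primrec fun x : ℕ × List ℕ × ℕ => dec x.2.2 :=
      hdec.comp (Primrec.snd.comp .snd)
    have hh' : Primrec fun x : ℕ × List ℕ × ℕ =>
        h (x.1, x.2.1, (dec x.2.2).1, (dec x.2.2).2.1) :=
      hh.comp (Primrec.fst.pair ((Primrec.fst.comp .snd).pair
        ((Primrec.fst.comp hc).pair (Primrec.fst.comp (Primrec.snd.comp hc)))))
    exact (computable_assembleCode hg).comp (Primrec.to_comp ((Primrec.fst.comp hc).pair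
      ((Primrec.snd.comp (Primrec.snd.comp hc)).pair hh')))
  · have hcodes : ∀ c : ℕ × List (List ℕ) × List ℕ,
        (conjDisjunct Φ (as i n) c).map (fun d => (d.1, formulaCode d.2.1)) =
          assembleCode g c.1 c.2.2 (h (key' i, List.ofFn n, c.1, c.2.1)) := fun c => by
      simp only [conjDisjunct, Option.map_map, has, assembleCode_eq key Φ hgΦ]
      rfl
    simp only [hdec', SigmaOne.codes, conjFormula, hcodes]

end Computability

/-! ### The auxiliary formulas -/

section Base

variable {L : Language} {l : ℕ}

/-- A `Σ₁` formula about tuples of length `l`, regarded as a generalized one that no tuple of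
another length satisfies. -/
def fixedLength (φ : SigmaOne L (TupleVar fun _ : Fin 1 => l)) : GenSigmaOne L 1 := fun n =>
  if h : (fun _ => l) = n then h ▸ φ else fun _ => none

theorem fixedLength_holds {B : Type*} [L.Structure B]
    (φ : SigmaOne L (TupleVar fun _ : Fin 1 => l)) (x : Tuple B) :
    (fixedLength φ).Holds ![x] ↔
      ∃ c : Fin l → B, x = ⟨l, c⟩ ∧ φ.Realize (fun v => c v.2) := by
  have key : ∀ (n : Fin 1 → ℕ) (h : (fun _ => l) = n) (v : TupleVar n → B),
      (fixedLength φ n).Realize v ↔ φ.Realize fun y => v ⟨y.1, y.2.cast (congrFun h y.1)⟩ := by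
    rintro n rfl v
    simp only [fixedLength, dite_true]
    rfl
  obtain ⟨m, x⟩ := x
  by_cases h : l = m
  · subst h
    have h := key (fun p => ((![⟨l, x⟩] : Fin 1 → Tuple B) p).1)
      (funext fun p => by fin_cases p; rfl) fun v => ((![⟨l, x⟩] : Fin 1 → Tuple B) v.1).2 v.2
    refine h.trans ?_
    have : (fun y : TupleVar fun _ : Fin 1 => l => ((![⟨l, x⟩] : Fin 1 → Tuple B) y.1).2
        (y.2.cast (by obtain ⟨p, q⟩ := y; fin_cases p; rfl))) = fun v => x v.2 := by
      funext ⟨p, q⟩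
      fin_cases p
      rfl
    rw [this]
    refine ⟨fun h => ⟨x, rfl, h⟩, ?_⟩
    rintro ⟨c, hc, h⟩
    cases hc
    exact h
  · refine iff_of_false ?_ ?_
    · rintro ⟨j, d, hd, -⟩
      have : (fun _ => l) ≠ fun p => ((![⟨m, x⟩] : Fin 1 → Tuple B) p).1 := fun e =>
        h (congrFun e 0)
      rw [show fixedLength φ _ = fun _ => none from dif_neg this] at hd
      cases hd
    · rintro ⟨c, hc, -⟩
      exact h (congrArg Sigma.fst hc).symm

/-- Two tuples are different. -/
def tupleNe (L : Language) : GenSigmaOne L 2 := fun n j =>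
  -- For different lengths every disjunct is the true sentence `⊥ → ⊥`.
  if n 0 ≠ n 1 then some ⟨0, .imp .falsum .falsum, .imp .falsum .falsum⟩
  -- For equal lengths the `j`-th disjunct says that the tuples differ at place `j`.
  else if h : j < n 0 ∧ j < n 1 then
    some ⟨0, .imp (.equal (.var (.inl ⟨0, j, h.1⟩)) (.var (.inl ⟨1, j, h.2⟩))) .falsum,
      .imp (.of_isAtomic (.equal _ _)) .falsum⟩
  else none

theorem tupleNe_holds {B : Type*} [L.Structure B] (x y : Tuple B) :
    (tupleNe L).Holds ![x, y] ↔ x ≠ y := by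
  obtain ⟨m, x⟩ := x
  obtain ⟨m', y⟩ := y
  change (∃ j, ∃ d ∈ (tupleNe L) (fun p => ((![⟨m, x⟩, ⟨m', y⟩] : Fin 2 → Tuple B) p).1) j,
    ∃ z : Fin d.1 → B, d.2.1.Realize
      (fun v => ((![⟨m, x⟩, ⟨m', y⟩] : Fin 2 → Tuple B) v.1).2 v.2) z) ↔ _
  by_cases h : m = m'
  · subst h
    simp only [ne_eq, Sigma.mk.injEq, heq_eq_eq, true_and]
    constructor
    · rintro ⟨j, d, hd, z, hz⟩ rfl
      have e := hd.symm.trans (if_neg (not_not.2 (rfl : m = m)))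
      by_cases hj : j < m ∧ j < m
      · have e' := e.trans (dif_pos hj)
        cases e'
        exact hz rfl
      · exact Option.some_ne_none _ (e.trans (dif_neg hj))
    · intro hxy
      obtain ⟨q, hq⟩ := Function.ne_iff.1 hxy
      refine ⟨q, _, (if_neg (not_not.2 (rfl : m = m))).trans
        (dif_pos (show (q : ℕ) < m ∧ (q : ℕ) < m from ⟨q.2, q.2⟩)), finZeroElim, fun h => hq h⟩
  · refine iff_of_true ?_ fun e => h (congrArg Sigma.fst e)
    exact ⟨0, _, if_pos h, finZeroElim, fun h => h⟩

/-- The names of the formulas from which the interpretation is built. -/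
inductive AuxFormula (ι : Type*)
  | orb : AuxFormula ι
  | dom : AuxFormula ι
  | iso : AuxFormula ι
  | ne : AuxFormula ι
  | rel (i : ι) : AuxFormula ι

namespace AuxFormula

variable {ι : Type*}

/-- The number of a name. -/
def key (c : ι → ℕ) : AuxFormula ι → ℕ
  | orb => 0
  | dom => 1
  | iso => 2
  | ne => 3
  -- The shift keeps the relation formulas apart from the four fixed names.
  | rel i => c i + 4

/-- The number of tuple variables. -/
def arity (r : ι → ℕ) : AuxFormula ι → ℕ
  | orb => 1
  | dom => 2
  | iso => 4
  | ne => 2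
  | rel i => r i + 1

/-- The named formula. -/
def formula {r : ι → ℕ} (φ : SigmaOne L (TupleVar fun _ : Fin 1 => l)) (δ : GenSigmaOne L 2)
    (ψ : GenSigmaOne L 4) (P : ∀ i, GenSigmaOne L (r i + 1)) :
    ∀ s : AuxFormula ι, GenSigmaOne L (s.arity r)
  | orb => fixedLength φ
  | dom => δ
  | iso => ψ
  | ne => tupleNe L
  | rel i => P i

end AuxFormula

variable [ComputableLanguage L]

theorem codes_fixedLength (φ : SigmaOne L (TupleVar fun _ : Fin 1 => l)) (n : Fin 1 → ℕ) (j : ℕ) :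
    (fixedLength φ n).codes j = if List.ofFn n = [l] then φ.codes j else none := by
  by_cases h : (fun _ => l) = n
  · subst h
    simp [fixedLength]
  · have h' : n 0 ≠ l := fun e => h (funext fun p => by fin_cases p; exact e.symm)
    simp [fixedLength, h, h', SigmaOne.codes]

theorem codes_tupleNe (n : Fin 2 → ℕ) (j : ℕ) :
    (tupleNe L n).codes j =
      if (List.ofFn n).getD 0 0 = (List.ofFn n).getD 1 0 then
        if j < (List.ofFn n).getD 0 0 then
          some (0, [Token.logic 2, Token.logic 1, Token.free 0 j, Token.free 1 j, Token.logic 0])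
        else none
      else some (0, [Token.logic 2, Token.logic 0, Token.logic 0]) := by
  by_cases h : n 0 = n 1
  · by_cases hj : j < n 1
    · simp [SigmaOne.codes, tupleNe, h, hj, formulaCode, termCode, Language.Term.listEncode,
        termToken]
    · simp [SigmaOne.codes, tupleNe, h, hj]
  · simp [SigmaOne.codes, tupleNe, h, formulaCode]

/-- The separate enumerations merge into one by a case distinction on the number of the name. -/
theorem isComputableSeq_formula {ι : Type*} {c r : ι → ℕ}
    {φ : SigmaOne L (TupleVar fun _ : Fin 1 => l)} (hφ : φ.IsComputable)
    {δ : GenSigmaOne L 2} (hδ : δ.IsComputable) {ψ : GenSigmaOne L 4} (hψ : ψ.IsComputable)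
    {P : ∀ i, GenSigmaOne L (r i + 1)} (hP : IsComputableSeq c P) :
    IsComputableSeq (AuxFormula.key c) (AuxFormula.formula φ δ ψ P) := by
  obtain ⟨gd, hgd, hd⟩ := hδ
  obtain ⟨gi, hgi, hi⟩ := hψ
  obtain ⟨gr, hgr, hr⟩ := hP
  let go : List ℕ × ℕ → Option (ℕ × List Token) := fun x =>
    if x.1 = [l] then φ.codes x.2 else none
  let gn : List ℕ × ℕ → Option (ℕ × List Token) := fun x =>
    if x.1.getD 0 0 = x.1.getD 1 0 then
      if x.2 < x.1.getD 0 0 then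
        some (0, [Token.logic 2, Token.logic 1, Token.free 0 x.2, Token.free 1 x.2, Token.logic 0])
      else none
    else some (0, [Token.logic 2, Token.logic 0, Token.logic 0])
  have hgo : Computable go := by
    have hc : Primrec fun x : List ℕ × ℕ => decide (x.1 = [l]) :=
      (Primrec.eq.comp .fst (.const _)).decide
    refine (Computable.cond hc.to_comp (hφ.comp .snd) (.const none)).of_eq fun x => ?_
    by_cases h : x.1 = [l] <;> simp [go, h]
  have hgn : Primrec gn := by
    have h0 : Primrec fun x : List ℕ × ℕ => x.1.getD 0 0 :=
      (Primrec.list_getD 0).comp .fst (.const 0)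
    have h1 : Primrec fun x : List ℕ × ℕ => x.1.getD 1 0 :=
      (Primrec.list_getD 0).comp .fst (.const 1)
    have hf : ∀ p, Primrec fun x : List ℕ × ℕ => Token.free p x.2 := fun p =>
      (Primrec.const 0).pair ((Primrec.const p).pair .snd)
    have hl : Primrec fun x : List ℕ × ℕ =>
        [Token.logic 2, Token.logic 1, Token.free 0 x.2, Token.free 1 x.2, Token.logic 0] :=
      Primrec.list_cons.comp (.const _) (Primrec.list_cons.comp (.const _)
        (Primrec.list_cons.comp (hf 0) (Primrec.list_cons.comp (hf 1) (.const _))))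
    exact Primrec.ite (Primrec.eq.comp h0 h1)
      (Primrec.ite (Primrec.nat_lt.comp .snd h0)
        (Primrec.option_some.comp ((Primrec.const 0).pair hl)) (.const none)) (.const _)
  -- A single generalized formula is a sequence with one index, numbered `0`; hence the first
  -- argument of `gd` and `gi`.
  let g : ℕ × List ℕ × ℕ → Option (ℕ × List Token) := fun x =>
    Nat.casesOn x.1 (go x.2) fun s => Nat.casesOn s (gd (0, x.2)) fun s =>
      Nat.casesOn s (gi (0, x.2)) fun s => Nat.casesOn s (gn x.2) fun s => gr (s, x.2)
  refine ⟨g, ?_, ?_⟩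
  · have e1 : Computable fun y : (((ℕ × List ℕ × ℕ) × ℕ) × ℕ) × ℕ => y.1.1.1.2 :=
      Computable.snd.comp (Computable.fst.comp (Computable.fst.comp .fst))
    have e4 : Computable fun y : ((((ℕ × List ℕ × ℕ) × ℕ) × ℕ) × ℕ) × ℕ => gr (y.2, y.1.1.1.1.2) :=
      hgr.comp (Computable.snd.pair (e1.comp .fst))
    have e3 : Computable fun y : (((ℕ × List ℕ × ℕ) × ℕ) × ℕ) × ℕ =>
        (Nat.casesOn y.2 (gn y.1.1.1.2) fun s => gr (s, y.1.1.1.2) : Option (ℕ × List Token)) :=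
      Computable.nat_casesOn .snd (hgn.to_comp.comp e1) e4
    have e2 : Computable fun y : ((ℕ × List ℕ × ℕ) × ℕ) × ℕ =>
        (Nat.casesOn y.2 (gi (0, y.1.1.2)) fun s => Nat.casesOn s (gn y.1.1.2) fun s =>
          gr (s, y.1.1.2) : Option (ℕ × List Token)) :=
      Computable.nat_casesOn .snd (hgi.comp ((Computable.const 0).pair
        (Computable.snd.comp (Computable.fst.comp .fst)))) e3
    have e1 : Computable fun y : (ℕ × List ℕ × ℕ) × ℕ =>
        (Nat.casesOn y.2 (gd (0, y.1.2)) fun s => Nat.casesOn s (gi (0, y.1.2)) fun s =>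
          Nat.casesOn s (gn y.1.2) fun s => gr (s, y.1.2) : Option (ℕ × List Token)) :=
      Computable.nat_casesOn .snd (hgd.comp ((Computable.const 0).pair
        (Computable.snd.comp .fst))) e2
    exact Computable.nat_casesOn .fst (hgo.comp .snd) e1
  · rintro (_ | _ | _ | _ | i) n j
    · exact (codes_fixedLength φ n j).symm
    · exact hd () n j
    · exact hi () n j
    · exact (codes_tupleNe n j).symm
    · exact hr i n j

end Base

/-! ### The formulas of the interpretation -/

section Variables

variable {k₀ : ℕ} {n : Fin k₀ → ℕ} {M : ℕ}

/-- The first `l` entries of a tuple. -/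
def tupleTake {B : Type*} (l : ℕ) (x : Tuple B) : Tuple B := tupleOf ((List.ofFn x.2).take l)

/-- The entries of a tuple after the first `l` ones. -/
def tupleDrop {B : Type*} (l : ℕ) (x : Tuple B) : Tuple B := tupleOf ((List.ofFn x.2).drop l)

/-- The first `l` entries of the `p`-th tuple variable. -/
def takeVars (l : ℕ) (p : Fin k₀) : List (TupleVar n ⊕ Fin M) :=
  (List.ofFn fun q => Sum.inl ⟨p, q⟩).take l

/-- The entries of the `p`-th tuple variable after the first `l` ones. -/
def dropVars (l : ℕ) (p : Fin k₀) : List (TupleVar n ⊕ Fin M) :=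
  (List.ofFn fun q => Sum.inl ⟨p, q⟩).drop l

/-- The letters of `takeVars`. -/
def takeCode (l : ℕ) (x : ℕ × List ℕ × ℕ × List (List ℕ)) (p : ℕ) : List Token :=
  ((List.range (x.2.1.getD p 0)).map (Token.free p)).take l

/-- The letters of `dropVars`. -/
def dropCode (l : ℕ) (x : ℕ × List ℕ × ℕ × List (List ℕ)) (p : ℕ) : List Token :=
  ((List.range (x.2.1.getD p 0)).map (Token.free p)).drop l

/-- The letters of the `p`-th tuple of bound variables. -/
def boundCode (x : ℕ × List ℕ × ℕ × List (List ℕ)) (p : ℕ) : List Token :=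
  ((x.2.2.2.getD p []).filter (· < x.2.2.1)).map Token.bound

theorem map_range_free (n : Fin k₀ → ℕ) (M : ℕ) (p : Fin k₀) :
    (List.range ((List.ofFn n).getD p 0)).map (Token.free p) =
      (List.ofFn fun q => (Sum.inl ⟨p, q⟩ : TupleVar n ⊕ Fin M)).map varToken := by
  rw [List.map_ofFn]
  refine List.ext_getElem (by simp [List.getD_eq_getElem?_getD]) fun q _ _ => ?_
  simp [varToken]

theorem map_takeVars (l c : ℕ) (e : List (List ℕ)) (p : Fin k₀) :
    (takeVars l p : List (TupleVar n ⊕ Fin M)).map varToken =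
      takeCode l (c, List.ofFn n, M, e) p := by
  rw [takeCode, map_range_free n M p, takeVars, List.map_take]

theorem map_dropVars (l c : ℕ) (e : List (List ℕ)) (p : Fin k₀) :
    (dropVars l p : List (TupleVar n ⊕ Fin M)).map varToken =
      dropCode l (c, List.ofFn n, M, e) p := by
  rw [dropCode, map_range_free n M p, dropVars, List.map_drop]

theorem map_selectVars (c : ℕ) (ns : List ℕ) (e : List (List ℕ)) (p : ℕ) :
    ((selectVars M e p).map Sum.inr : List (TupleVar n ⊕ Fin M)).map varToken =
      boundCode (c, ns, M, e) p := by
  simp only [selectVars, boundCode]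
  generalize e.getD p [] = is
  induction is with
  | nil => rfl
  | cons i is ih =>
    by_cases h : i < M
    · simp only [List.filterMap_cons, h, dite_true, List.map_cons, ih, List.filter_cons,
        decide_true, if_true]
      rfl
    · simp only [List.filterMap_cons, h, dite_false, ih, List.filter_cons, decide_false]
      rfl

theorem primrec_free : Primrec₂ Token.free :=
  (Primrec.const 0).pair (Primrec.fst.pair .snd)

theorem primrec_range_free :
    Primrec₂ fun (x : ℕ × List ℕ × ℕ × List (List ℕ)) (p : ℕ) =>
      (List.range (x.2.1.getD p 0)).map (Token.free p) :=
  Primrec.list_map (Primrec.list_range.comp ((Primrec.list_getD 0).comp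
    (Primrec.fst.comp (Primrec.snd.comp .fst)) .snd))
    (primrec_free.comp (Primrec.snd.comp .fst) .snd)

theorem primrec_takeCode (l : ℕ) : Primrec₂ (takeCode l) :=
  Primrec.list_take.comp (.const l) primrec_range_free

theorem primrec_dropCode (l : ℕ) : Primrec₂ (dropCode l) :=
  Primrec.list_drop.comp (.const l) primrec_range_free

theorem primrec_boundCode : Primrec₂ boundCode := by
  have h : Primrec₂ fun (is : List ℕ) (M : ℕ) => is.filter fun i => i < M :=
    PrimrecRel.listFilter Primrec.nat_lt
  have hf : Primrec fun y : (ℕ × List ℕ × ℕ × List (List ℕ)) × ℕ =>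
      (y.1.2.2.2.getD y.2 []).filter (· < y.1.2.2.1) :=
    h.comp ((Primrec.list_getD []).comp (Primrec.snd.comp (Primrec.snd.comp (Primrec.snd.comp .fst)))
      .snd) (Primrec.fst.comp (Primrec.snd.comp (Primrec.snd.comp .fst)))
  exact Primrec.list_map hf ((Primrec.const 1).pair (Primrec.snd.pair (.const 0)))

variable {B : Type*}

theorem tupleOf_takeVars (l : ℕ) (xs : Fin k₀ → Tuple B) (w : Fin M → B) (p : Fin k₀) :
    tupleOf ((takeVars (n := fun p => (xs p).1) l p).map
      (Sum.elim (fun v => (xs v.1).2 v.2) w)) = tupleTake l (xs p) := by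
  rw [takeVars, List.map_take, List.map_ofFn]
  rfl

theorem tupleOf_dropVars (l : ℕ) (xs : Fin k₀ → Tuple B) (w : Fin M → B) (p : Fin k₀) :
    tupleOf ((dropVars (n := fun p => (xs p).1) l p).map
      (Sum.elim (fun v => (xs v.1).2 v.2) w)) = tupleDrop l (xs p) := by
  rw [dropVars, List.map_drop, List.map_ofFn]
  rfl

theorem exists_tupleOf_selectVars {K : ℕ} (t : Fin K → Tuple B) :
    ∃ (M : ℕ) (e : List (List ℕ)) (w : Fin M → B), ∀ p : Fin K,
      tupleOf ((selectVars M e p).map w) = t p := by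
  obtain ⟨M, e, w, h⟩ := exists_selectVars fun p => List.ofFn (t p).2
  exact ⟨M, e, w, fun p => (tupleOf_eq_iff _ _).2 (h p)⟩

end Variables

section Interpretation

variable {L : Language} {l : ℕ} {ι : Type*} {c r : ι → ℕ}
  {φ : SigmaOne L (TupleVar fun _ : Fin 1 => l)} {δ : GenSigmaOne L 2} {ψ : GenSigmaOne L 4}
  {P : ∀ i, GenSigmaOne L (r i + 1)} {B : Type*} [L.Structure B]

namespace AuxFormula

variable {V : Type*}

/-- The atomic expression `φ(u)`. -/
def orbAtom (r : ι → ℕ) (u : List V) : Atom (arity r) V := ⟨.orb, (![u] : Fin 1 → List V)⟩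

/-- The atomic expression `δ(u; x)`. -/
def domAtom (r : ι → ℕ) (u x : List V) : Atom (arity r) V := ⟨.dom, (![u, x] : Fin 2 → List V)⟩

/-- The atomic expression `ψ(u, v; x, y)`. -/
def isoAtom (r : ι → ℕ) (u v x y : List V) : Atom (arity r) V :=
  ⟨.iso, (![u, v, x, y] : Fin 4 → List V)⟩

/-- The atomic expression `x ≠ y`. -/
def neAtom (r : ι → ℕ) (x y : List V) : Atom (arity r) V := ⟨.ne, (![x, y] : Fin 2 → List V)⟩

/-- The atomic expression `P i (u; x)`. -/
def relAtom (r : ι → ℕ) (i : ι) (u : List V) (x : Fin (r i) → List V) : Atom (arity r) V :=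
  ⟨.rel i, (Fin.cons u x : Fin (r i + 1) → List V)⟩

theorem holds_orbAtom (u : List V) (v : V → B) :
    (orbAtom r u).Holds (formula φ δ ψ P) v ↔ (fixedLength φ).Holds ![tupleOf (u.map v)] := by
  refine iff_of_eq (congrArg (fixedLength φ).Holds ?_)
  funext p
  fin_cases p
  rfl

theorem holds_domAtom (u x : List V) (v : V → B) :
    (domAtom r u x).Holds (formula φ δ ψ P) v ↔
      δ.Holds ![tupleOf (u.map v), tupleOf (x.map v)] := by
  refine iff_of_eq (congrArg δ.Holds ?_)
  funext p
  fin_cases p <;> rfl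

theorem holds_isoAtom (u u' x y : List V) (v : V → B) :
    (isoAtom r u u' x y).Holds (formula φ δ ψ P) v ↔
      ψ.Holds ![tupleOf (u.map v), tupleOf (u'.map v), tupleOf (x.map v), tupleOf (y.map v)] := by
  refine iff_of_eq (congrArg ψ.Holds ?_)
  funext p
  fin_cases p <;> rfl

theorem holds_neAtom (x y : List V) (v : V → B) :
    (neAtom r x y).Holds (formula φ δ ψ P) v ↔ tupleOf (x.map v) ≠ tupleOf (y.map v) := by
  refine Iff.trans (iff_of_eq (congrArg (tupleNe L).Holds ?_)) (tupleNe_holds _ _)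
  funext p
  fin_cases p <;> rfl

theorem holds_relAtom (i : ι) (u : List V) (x : Fin (r i) → List V) (v : V → B) :
    (relAtom r i u x).Holds (formula φ δ ψ P) v ↔
      (P i).Holds (Fin.cons (α := fun _ => Tuple B) (tupleOf (u.map v))
        fun p => tupleOf ((x p).map v)) := by
  refine iff_of_eq (congrArg (P i).Holds ?_)
  funext p
  refine Fin.cases ?_ (fun p => ?_) p <;> rfl

variable {k₀ : ℕ} {n : Fin k₀ → ℕ} {M : ℕ}

theorem code_orbAtom (u : List (TupleVar n ⊕ Fin M)) :
    (orbAtom r u).code (key c) = (0, [u.map varToken]) := rfl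

theorem code_domAtom (u x : List (TupleVar n ⊕ Fin M)) :
    (domAtom r u x).code (key c) = (1, [u.map varToken, x.map varToken]) := rfl

theorem code_isoAtom (u v x y : List (TupleVar n ⊕ Fin M)) :
    (isoAtom r u v x y).code (key c) =
      (2, [u.map varToken, v.map varToken, x.map varToken, y.map varToken]) := rfl

theorem code_neAtom (x y : List (TupleVar n ⊕ Fin M)) :
    (neAtom r x y).code (key c) = (3, [x.map varToken, y.map varToken]) := rfl

theorem code_relAtom (i : ι) (u : List (TupleVar n ⊕ Fin M))
    (x : Fin (r i) → List (TupleVar n ⊕ Fin M)) :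
    (relAtom r i u x).code (key c) =
      (c i + 4, u.map varToken :: List.ofFn fun p => (x p).map varToken) := by
  refine Prod.ext rfl ?_
  exact List.ofFn_succ

end AuxFormula

open AuxFormula

end Interpretation

/-! ### `Σ₁` definitions of the domain, the equivalence and the relations -/

section InterpretationFormulas

open AuxFormula

variable {L : Language} {l : ℕ} {B : Type*} [L.Structure B]

theorem holds_conjFormula {ι : Type*} {k : ι → ℕ} (Φ : ∀ i, GenSigmaOne L (k i)) {k₀ : ℕ}
    (as : ∀ (n : Fin k₀ → ℕ) (M : ℕ), (ℕ → List (Fin M)) → List (Atom k (TupleVar n ⊕ Fin M)))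
    (xs : Fin k₀ → Tuple B) :
    (conjFormula Φ as).Holds xs ↔ ∃ (M : ℕ) (e : List (List ℕ)) (w : Fin M → B),
      ∀ a ∈ as (fun p => (xs p).1) M (selectVars M e),
        a.Holds Φ (Sum.elim (fun x => (xs x.1).2 x.2) w) :=
  realize_conjFormula Φ as _ _

theorem tupleOf_boundVars {V M : Type*} (v : V → B) (w : M → B) (z : List M) :
    tupleOf ((z.map Sum.inr : List (V ⊕ M)).map (Sum.elim v w)) = tupleOf (z.map w) := by
  rw [List.map_map]
  rfl

variable [ComputableLanguage L]
  {φ : SigmaOne L (TupleVar fun _ : Fin 1 => l)} {δ : GenSigmaOne L 2} {ψ : GenSigmaOne L 4}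

/-- Fills the slot of the relation formulas where the domain and the equivalence are defined, since
no relation occurs there. -/
theorem isComputableSeq_empty (r : Empty → ℕ) (P : ∀ i, GenSigmaOne L (r i + 1)) :
    IsComputableSeq Empty.elim P :=
  ⟨fun _ => none, .const none, fun i => i.elim⟩

theorem exists_isComputable_dom (hφ : φ.IsComputable) (hδ : δ.IsComputable)
    (hψ : ψ.IsComputable) :
    ∃ F : GenSigmaOne L 1, F.IsComputable ∧ ∀ x : Tuple B, F.Holds ![x] ↔
      (fixedLength φ).Holds ![tupleTake l x] ∧ δ.Holds ![tupleTake l x, tupleDrop l x] := by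
  have hP := isComputableSeq_empty (fun _ => 0) fun i => (i.elim : GenSigmaOne L 1)
  refine ⟨conjFormula _ fun n M Z =>
    [orbAtom _ (takeVars l 0), domAtom _ (takeVars l 0) (dropVars l 0)],
    isComputableSeq_conjFormula _ _ _ (isComputableSeq_formula hφ hδ hψ hP) _
      (fun x => [(0, [takeCode l x 0]), (1, [takeCode l x 0, dropCode l x 0])]) ?_ ?_, ?_⟩
  · have ht := (primrec_takeCode l).comp .id (.const 0)
    have hd := (primrec_dropCode l).comp .id (.const 0)
    exact Primrec.list_cons.comp ((Primrec.const 0).pair (Primrec.list_cons.comp ht (.const [])))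
      (Primrec.list_cons.comp ((Primrec.const 1).pair (Primrec.list_cons.comp ht
        (Primrec.list_cons.comp hd (.const [])))) (.const []))
  · intro i n M e
    simp only [List.map_cons, List.map_nil, code_orbAtom, code_domAtom, map_takeVars l 0 e,
      map_dropVars l 0 e]
    rfl
  · intro x
    simp only [holds_conjFormula, List.forall_mem_cons, holds_orbAtom, holds_domAtom,
      tupleOf_takeVars, tupleOf_dropVars]
    simp only [List.not_mem_nil, false_implies, implies_true, and_true]
    -- No auxiliary tuple is quantified, so zero bound variables suffice.
    exact ⟨fun ⟨_, _, _, h⟩ => h, fun h => ⟨0, [], finZeroElim, h⟩⟩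

/-- No conjunct `δ` is required: when `ψ` defines the graphs of the isomorphisms, it already forces
both remainders into the right domains. -/
theorem exists_isComputable_eqv (hφ : φ.IsComputable) (hδ : δ.IsComputable)
    (hψ : ψ.IsComputable) :
    ∃ F : GenSigmaOne L 2, F.IsComputable ∧ ∀ x y : Tuple B, F.Holds ![x, y] ↔
      (fixedLength φ).Holds ![tupleTake l x] ∧ (fixedLength φ).Holds ![tupleTake l y] ∧
        ψ.Holds ![tupleTake l x, tupleTake l y, tupleDrop l x, tupleDrop l y] := by
  have hP := isComputableSeq_empty (fun _ => 0) fun i => (i.elim : GenSigmaOne L 1)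
  refine ⟨conjFormula _ fun n M Z =>
    [orbAtom _ (takeVars l 0), orbAtom _ (takeVars l 1),
      isoAtom _ (takeVars l 0) (takeVars l 1) (dropVars l 0) (dropVars l 1)],
    isComputableSeq_conjFormula _ _ _ (isComputableSeq_formula hφ hδ hψ hP) _
      (fun x => [(0, [takeCode l x 0]), (0, [takeCode l x 1]),
        (2, [takeCode l x 0, takeCode l x 1, dropCode l x 0, dropCode l x 1])]) ?_ ?_, ?_⟩
  · have ht := fun p => (primrec_takeCode l).comp .id (.const p)
    have hd := fun p => (primrec_dropCode l).comp .id (.const p)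
    exact Primrec.list_cons.comp
      ((Primrec.const 0).pair (Primrec.list_cons.comp (ht 0) (.const [])))
      (Primrec.list_cons.comp
        ((Primrec.const 0).pair (Primrec.list_cons.comp (ht 1) (.const [])))
        (Primrec.list_cons.comp ((Primrec.const 2).pair (Primrec.list_cons.comp (ht 0)
          (Primrec.list_cons.comp (ht 1) (Primrec.list_cons.comp (hd 0)
            (Primrec.list_cons.comp (hd 1) (.const [])))))) (.const [])))
  · intro i n M e
    simp only [List.map_cons, List.map_nil, code_orbAtom, code_isoAtom, map_takeVars l 0 e,
      map_dropVars l 0 e]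
    rfl
  · intro x y
    simp only [holds_conjFormula, List.forall_mem_cons, holds_orbAtom, holds_isoAtom,
      tupleOf_takeVars, tupleOf_dropVars]
    simp only [List.not_mem_nil, false_implies, implies_true, and_true]
    exact ⟨fun ⟨_, _, _, h⟩ => h, fun h => ⟨0, [], finZeroElim, h⟩⟩

/-- The negation of `ψ` need not be `Σ₁`, but "the image `z` differs from the remainder of `y`" is.
Here `δ` is needed, as `ψ` says nothing about `y` beyond its parameters. -/
theorem exists_isComputable_neqv (hφ : φ.IsComputable) (hδ : δ.IsComputable)
    (hψ : ψ.IsComputable) :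
    ∃ F : GenSigmaOne L 2, F.IsComputable ∧ ∀ x y : Tuple B, F.Holds ![x, y] ↔
      ∃ z : Tuple B, (fixedLength φ).Holds ![tupleTake l x] ∧
        (fixedLength φ).Holds ![tupleTake l y] ∧
        ψ.Holds ![tupleTake l x, tupleTake l y, tupleDrop l x, z] ∧
        δ.Holds ![tupleTake l y, tupleDrop l y] ∧ z ≠ tupleDrop l y := by
  have hP := isComputableSeq_empty (fun _ => 0) fun i => (i.elim : GenSigmaOne L 1)
  refine ⟨conjFormula _ fun n M Z =>
    [orbAtom _ (takeVars l 0), orbAtom _ (takeVars l 1),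
      isoAtom _ (takeVars l 0) (takeVars l 1) (dropVars l 0) ((Z 0).map .inr),
      domAtom _ (takeVars l 1) (dropVars l 1), neAtom _ ((Z 0).map .inr) (dropVars l 1)],
    isComputableSeq_conjFormula _ _ _ (isComputableSeq_formula hφ hδ hψ hP) _
      (fun x => [(0, [takeCode l x 0]), (0, [takeCode l x 1]),
        (2, [takeCode l x 0, takeCode l x 1, dropCode l x 0, boundCode x 0]),
        (1, [takeCode l x 1, dropCode l x 1]), (3, [boundCode x 0, dropCode l x 1])]) ?_ ?_, ?_⟩
  · have ht := fun p => (primrec_takeCode l).comp .id (.const p)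
    have hd := fun p => (primrec_dropCode l).comp .id (.const p)
    have hb := primrec_boundCode.comp .id (.const 0)
    have h1 := (Primrec.const 0).pair (Primrec.list_cons.comp (ht 0) (.const []))
    have h2 := (Primrec.const 0).pair (Primrec.list_cons.comp (ht 1) (.const []))
    have h3 := (Primrec.const 2).pair (Primrec.list_cons.comp (ht 0)
      (Primrec.list_cons.comp (ht 1) (Primrec.list_cons.comp (hd 0)
        (Primrec.list_cons.comp hb (.const [])))))
    have h4 := (Primrec.const 1).pair (Primrec.list_cons.comp (ht 1)
      (Primrec.list_cons.comp (hd 1) (.const [])))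
    have h5 := (Primrec.const 3).pair (Primrec.list_cons.comp hb
      (Primrec.list_cons.comp (hd 1) (.const [])))
    exact Primrec.list_cons.comp h1 (Primrec.list_cons.comp h2 (Primrec.list_cons.comp h3
      (Primrec.list_cons.comp h4 (Primrec.list_cons.comp h5 (.const [])))))
  · intro i n M e
    simp only [List.map_cons, List.map_nil, code_orbAtom, code_isoAtom, code_domAtom,
      code_neAtom, map_takeVars l 0 e, map_dropVars l 0 e, map_selectVars 0 (List.ofFn n)]
    rfl
  · intro x y
    simp only [holds_conjFormula, List.forall_mem_cons, holds_orbAtom, holds_isoAtom,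
      holds_domAtom, holds_neAtom, tupleOf_takeVars, tupleOf_dropVars, tupleOf_boundVars]
    simp only [List.not_mem_nil, false_implies, implies_true, and_true]
    constructor
    · rintro ⟨M, e, w, h⟩
      exact ⟨_, h⟩
    · rintro ⟨z, h⟩
      obtain ⟨M, e, w, hz⟩ := exists_tupleOf_selectVars fun _ : Fin 1 => z
      exact ⟨M, e, w, (show tupleOf ((selectVars M e 0).map w) = z from hz 0).symm ▸ h⟩

/-- The arguments may carry different parameters, so they are moved to a common `u` before `P i` is
applied. Quantifying over `u`, instead of using the parameters of some argument, also covers arity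
zero. `P` will be both the positive and the negative family. -/
theorem exists_isComputableSeq_rel {ι : Type*} {c r : ι → ℕ} {P : ∀ i, GenSigmaOne L (r i + 1)}
    (hφ : φ.IsComputable) (hδ : δ.IsComputable) (hψ : ψ.IsComputable)
    (hP : IsComputableSeq c P) :
    ∃ F : ∀ i, GenSigmaOne L (r i), IsComputableSeq c F ∧
      ∀ (i : ι) (xs : Fin (r i) → Tuple B), (F i).Holds xs ↔
        ∃ (u : Tuple B) (z : Fin (r i) → Tuple B), (fixedLength φ).Holds ![u] ∧
          (P i).Holds (Fin.cons (α := fun _ => Tuple B) u z) ∧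
          (∀ p, (fixedLength φ).Holds ![tupleTake l (xs p)]) ∧
          ∀ p, ψ.Holds ![tupleTake l (xs p), u, tupleDrop l (xs p), z p] := by
  refine ⟨fun i => conjFormula _ fun n M Z =>
    -- The bound tuple `Z 0` plays the role of `u` and `Z (p + 1)` that of `z p`.
    orbAtom _ ((Z 0).map .inr) ::
      relAtom _ i ((Z 0).map .inr) (fun p => (Z (p + 1)).map .inr) ::
      ((List.ofFn fun p => orbAtom _ (takeVars l p)) ++
        List.ofFn fun p => isoAtom _ (takeVars l p) ((Z 0).map .inr) (dropVars l p)
          ((Z (p + 1)).map .inr)),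
    isComputableSeq_conjFormula _ _ _ (isComputableSeq_formula hφ hδ hψ hP) _
      (fun x => (0, [boundCode x 0]) ::
        (x.1 + 4, boundCode x 0 :: (List.range x.2.1.length).map fun p => boundCode x (p + 1)) ::
        (((List.range x.2.1.length).map fun p => (0, [takeCode l x p])) ++
          (List.range x.2.1.length).map fun p =>
            (2, [takeCode l x p, boundCode x 0, dropCode l x p, boundCode x (p + 1)]))) ?_ ?_, ?_⟩
  · have hb := primrec_boundCode.comp .id (.const 0)
    have hr := Primrec.list_range.comp (Primrec.list_length.comp (Primrec.fst.comp
      (Primrec.snd (α := ℕ) (β := List ℕ × ℕ × List (List ℕ)))))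
    have hbs : Primrec fun y : (ℕ × List ℕ × ℕ × List (List ℕ)) × ℕ => boundCode y.1 (y.2 + 1) :=
      primrec_boundCode.comp .fst (Primrec.succ.comp .snd)
    have h1 := (Primrec.const 0).pair (Primrec.list_cons.comp hb (.const []))
    have h2 := (Primrec.nat_add.comp .fst (.const 4)).pair
      (Primrec.list_cons.comp hb (Primrec.list_map hr hbs.to₂))
    have ht : Primrec fun y : (ℕ × List ℕ × ℕ × List (List ℕ)) × ℕ => takeCode l y.1 y.2 :=
      primrec_takeCode l
    have hd : Primrec fun y : (ℕ × List ℕ × ℕ × List (List ℕ)) × ℕ => dropCode l y.1 y.2 :=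
      primrec_dropCode l
    have h3 := Primrec.list_map hr
      ((Primrec.const 0).pair (Primrec.list_cons.comp ht (.const []))).to₂
    have h4 := Primrec.list_map hr
      ((Primrec.const 2).pair (Primrec.list_cons.comp ht (Primrec.list_cons.comp (hb.comp .fst)
        (Primrec.list_cons.comp hd (Primrec.list_cons.comp hbs (.const [])))))).to₂
    exact Primrec.list_cons.comp h1 (Primrec.list_cons.comp h2 (Primrec.list_append.comp h3 h4))
  · intro i n M e
    have hr : ∀ {α : Type} (f : ℕ → α),
        (List.range (List.ofFn n).length).map f = List.ofFn fun p : Fin (r i) => f p := by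
      intro α f
      rw [List.length_ofFn, List.ofFn_eq_map, ← List.map_coe_finRange_eq_range, List.map_map]
      rfl
    simp only [List.map_cons, List.map_append, List.map_ofFn, code_orbAtom, code_isoAtom,
      code_relAtom, map_takeVars l (c i) e, map_dropVars l (c i) e,
      map_selectVars (c i) (List.ofFn n), hr, Function.comp_def]
  · intro i xs
    simp only [holds_conjFormula, List.forall_mem_cons, List.forall_mem_append,
      List.forall_mem_ofFn_iff, holds_orbAtom, holds_isoAtom, holds_relAtom, tupleOf_takeVars,
      tupleOf_dropVars, tupleOf_boundVars]
    constructor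
    · rintro ⟨M, e, w, h⟩
      exact ⟨_, _, h⟩
    · rintro ⟨u, z, h⟩
      obtain ⟨M, e, w, hz⟩ := exists_tupleOf_selectVars
        (Fin.cons (α := fun _ => Tuple B) u z : Fin (r i + 1) → Tuple B)
      have h0 : tupleOf ((selectVars M e 0).map w) = u := hz 0
      have h1 : ∀ p : Fin (r i), tupleOf ((selectVars M e (p + 1)).map w) = z p :=
        fun p => by simpa using hz p.succ
      refine ⟨M, e, w, ?_⟩
      simpa only [h0, h1] using h

end InterpretationFormulas

/-! ### Invariance under automorphisms -/

section Automorphisms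

variable {L : Language} {B : Type*} [L.Structure B]

theorem SigmaOne.realize_comp_equiv {α : Type*} (φ : SigmaOne L α) (g : B ≃[L] B) (v : α → B) :
    φ.Realize (g ∘ v) ↔ φ.Realize v := by
  refine exists_congr fun j => exists_congr fun d => and_congr_right fun _ => ?_
  constructor
  · rintro ⟨y, hy⟩
    refine ⟨g.symm ∘ y, (Language.StrongHomClass.realize_boundedFormula g d.2.1).1 ?_⟩
    have : g ∘ g.symm ∘ y = y := funext fun p => g.apply_symm_apply _
    rwa [this]
  · rintro ⟨y, hy⟩
    exact ⟨g ∘ y, (Language.StrongHomClass.realize_boundedFormula g d.2.1).2 hy⟩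

/-- The image of a tuple under a map. -/
def mapTuple {C : Type*} (g : B → C) (x : Tuple B) : Tuple C := ⟨x.1, g ∘ x.2⟩

theorem GenSigmaOne.holds_mapTuple {k : ℕ} (φ : GenSigmaOne L k) (g : B ≃[L] B)
    (xs : Fin k → Tuple B) : (φ.Holds fun p => mapTuple g (xs p)) ↔ φ.Holds xs :=
  SigmaOne.realize_comp_equiv _ g _

theorem GenSigmaOne.holds_cons_mapTuple {k : ℕ} (φ : GenSigmaOne L (k + 1)) (g : B ≃[L] B)
    (c : Tuple B) (xs : Fin k → Tuple B) :
    φ.Holds (Fin.cons (α := fun _ => Tuple B) (mapTuple g c) fun p => mapTuple g (xs p)) ↔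
      φ.Holds (Fin.cons (α := fun _ => Tuple B) c xs) := by
  rw [← φ.holds_mapTuple g (Fin.cons c xs)]
  refine iff_of_eq (congrArg φ.Holds (funext fun p => ?_))
  refine Fin.cases ?_ (fun p => ?_) p <;> rfl

variable [ComputableLanguage L] {L' : Language} [ComputableLanguage L']

theorem DefiningFormulas.mem_domain_mapTuple (S : DefiningFormulas L L') (g : B ≃[L] B)
    (c x : Tuple B) : mapTuple g x ∈ S.Domain (mapTuple g c) ↔ x ∈ S.Domain c := by
  refine Iff.trans (iff_of_eq (congrArg S.dom.Holds (funext fun p => ?_)))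
    (S.dom.holds_mapTuple g ![c, x])
  fin_cases p <;> rfl

/-- Complementarity is assumed only at `b`; an automorphism taking `b` to `c` preserves satisfaction
of all the formulas and carries it over to `c`. -/
theorem DefiningFormulas.EffectivelyDefine.of_mem_autOrbit [L'.IsRelational]
    {S : DefiningFormulas L L'} {A : Type*} [L'.Structure A] {l : ℕ} {b : Fin l → B}
    (hS : S.EffectivelyDefine A (⟨l, b⟩ : Tuple B)) {c : Fin l → B} (hc : c ∈ autOrbit L b)
    (R : Σ n, L'.Relations n) (xs : Fin R.1 → Tuple B) :
    ((S.pos R).Holds (Fin.cons (α := fun _ => Tuple B) ⟨l, c⟩ xs) →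
      ∀ p, xs p ∈ S.Domain ⟨l, c⟩) ∧
    ((S.neg R).Holds (Fin.cons (α := fun _ => Tuple B) ⟨l, c⟩ xs) ↔
      (∀ p, xs p ∈ S.Domain ⟨l, c⟩) ∧
        ¬ (S.pos R).Holds (Fin.cons (α := fun _ => Tuple B) ⟨l, c⟩ xs)) := by
  obtain ⟨g, rfl⟩ := hc
  obtain ⟨ys, rfl⟩ : ∃ ys : Fin R.1 → Tuple B, xs = fun p => mapTuple g (ys p) :=
    ⟨fun p => mapTuple g.symm (xs p), funext fun p =>
      Sigma.ext rfl (heq_of_eq (funext fun q => (g.apply_symm_apply _).symm))⟩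
  have h := hS.1 R ys
  have hpos := (S.pos R).holds_cons_mapTuple g ⟨l, b⟩ ys
  have hneg := (S.neg R).holds_cons_mapTuple g ⟨l, b⟩ ys
  have hdom := fun p => S.mem_domain_mapTuple g ⟨l, b⟩ (ys p)
  rw [← hpos, ← hneg] at h
  simp only [← hdom] at h
  exact h

end Automorphisms

/-! ### The interpretation and its correctness -/

theorem tupleTake_append {B : Type*} {l : ℕ} (c : Fin l → B) (x : Tuple B) :
    tupleTake l (tupleOf (List.ofFn c ++ List.ofFn x.2)) = ⟨l, c⟩ := by
  refine (tupleOf_eq_iff _ _).2 ?_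
  rw [← (tupleOf_eq_iff _ _).1 rfl]
  exact List.take_left' (by simp)

theorem tupleDrop_append {B : Type*} {l : ℕ} (c : Fin l → B) (x : Tuple B) :
    tupleDrop l (tupleOf (List.ofFn c ++ List.ofFn x.2)) = x := by
  refine (tupleOf_eq_iff _ _).2 ?_
  rw [← (tupleOf_eq_iff _ _).1 rfl]
  exact List.drop_left' (by simp)

theorem mainTheorem6 {L L' : Language} [ComputableLanguage L] [ComputableLanguage L']
    [L'.IsRelational] {A B : Type*} [L'.Structure A] [L.Structure B]
    {l : ℕ} (b : Fin l → B)
    (S : DefiningFormulas L L') (hS : S.EffectivelyDefine A (⟨l, b⟩ : Tuple B))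
    (φ : SigmaOne L (TupleVar fun _ : Fin 1 => l)) (hφ : φ.IsComputable)
    (hφ_orbit : ∀ c : Fin l → B, φ.Realize (fun v => c v.2) ↔ c ∈ autOrbit L b)
    (ψ : GenSigmaOne L 4) (hψ : ψ.IsComputable)
    (f : ∀ c d : autOrbit L b, S.Domain ⟨l, c.1⟩ ≃[L'] S.Domain ⟨l, d.1⟩)
    (hψ_graph : ∀ (c d : autOrbit L b) (x y : Tuple B),
      ψ.Holds ![⟨l, c.1⟩, ⟨l, d.1⟩, x, y] ↔
        ∃ hx : x ∈ S.Domain ⟨l, c.1⟩, ((f c d ⟨x, hx⟩ : S.Domain ⟨l, d.1⟩) : Tuple B) = y)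
    (hf_id : ∀ (c : autOrbit L b) (x : S.Domain ⟨l, c.1⟩), f c c x = x)
    (hf_comp : ∀ (c d e : autOrbit L b) (x : S.Domain ⟨l, c.1⟩),
      f d e (f c d x) = f c e x) :
    EffectivelyInterpreted L L' A B := by
  have hb : b ∈ autOrbit L b := ⟨Language.Equiv.refl L B, rfl⟩
  have horb : ∀ x : Tuple B,
      (fixedLength φ).Holds ![x] ↔ ∃ c : autOrbit L b, x = ⟨l, c.1⟩ := by
    intro x
    rw [fixedLength_holds]
    simp only [hφ_orbit, Subtype.exists]
    exact exists_congr fun c => ⟨fun h => ⟨h.2, h.1⟩, fun ⟨h, h'⟩ => ⟨h', h⟩⟩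
  let D : Set (Tuple B) := {x | ∃ c : autOrbit L b, tupleTake l x = ⟨l, c.1⟩ ∧
    tupleDrop l x ∈ S.Domain ⟨l, c.1⟩}
  choose par hpar helt using fun x : D => x.2
  let F : D → S.Domain ⟨l, b⟩ := fun x => f (par x) ⟨b, hb⟩ ⟨tupleDrop l x, helt x⟩
  -- The chosen parameters are the only possible ones, since they are the first `l` entries; so `F`
  -- can be computed from any presentation of `x`.
  have hF : ∀ (x : D) (c : autOrbit L b), tupleTake l x = ⟨l, c.1⟩ →
      ∃ h : tupleDrop l x ∈ S.Domain ⟨l, c.1⟩, F x = f c ⟨b, hb⟩ ⟨tupleDrop l x, h⟩ := by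
    intro x c hc
    obtain rfl : par x = c := by
      have := (hpar x).symm.trans hc
      simp only [Sigma.mk.injEq, heq_eq_eq, true_and] at this
      exact Subtype.ext this
    exact ⟨helt x, rfl⟩
  -- The tuple `b⌢y` is sent to `y`, because `f b b = id`.
  have hFsurj : Function.Surjective F := by
    intro y
    have ht := tupleTake_append b y.1
    have hd := tupleDrop_append b y.1
    let x : D := ⟨_, ⟨b, hb⟩, ht, by rw [hd]; exact y.2⟩
    obtain ⟨h, hx⟩ := hF x ⟨b, hb⟩ ht
    refine ⟨x, hx.trans ((hf_id _ _).trans (Subtype.ext hd))⟩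
  let s : Setoid D := Setoid.ker F
  let str : L'.Structure D :=
    { funMap := fun g _ => isEmptyElim g
      RelMap := fun R xs => Language.Structure.RelMap R fun p => F (xs p) }
  let pre : L'.Prestructure s :=
    { toStructure := str
      fun_equiv := fun {_ g} => isEmptyElim g
      rel_equiv := fun {_ R} x y h =>
        congrArg (Language.Structure.RelMap (M := S.Domain ⟨l, b⟩) R) (funext fun p => (h p : F (x p) = F (y p))) }
  -- relations and elements read off at an arbitrary parameter tuple
  have hrel : ∀ (R : Σ n, L'.Relations n) (xs : Fin R.1 → D) (u : autOrbit L b)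
      (y : Fin R.1 → S.Domain ⟨l, u.1⟩), (∀ p, F (xs p) = f u ⟨b, hb⟩ (y p)) →
      (str.RelMap R.2 xs ↔ (S.pos R).Holds
        (Fin.cons (α := fun _ => Tuple B) ⟨l, u.1⟩ fun p => (y p : Tuple B))) := by
    intro R xs u y h
    have h' := (f u ⟨b, hb⟩).map_rel R.2 y
    refine Iff.trans ?_ h'
    exact iff_of_eq (congrArg (Language.Structure.RelMap R.2) (funext h))
  have hφx : ∀ x : Tuple B, x ∈ D ↔ (fixedLength φ).Holds ![tupleTake l x] ∧
      S.dom.Holds ![tupleTake l x, tupleDrop l x] := by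
    intro x
    rw [horb]
    constructor
    · rintro ⟨c, hc, hx⟩
      exact ⟨⟨c, hc⟩, hc ▸ hx⟩
    · rintro ⟨⟨c, hc⟩, hx⟩
      exact ⟨c, hc, hc ▸ hx⟩
  -- This eliminates `b`: factor `f c b` through `D(d)` and cancel the injective `f d b`.
  have hiso : ∀ (c d : autOrbit L b) (x : S.Domain ⟨l, c.1⟩) (y : S.Domain ⟨l, d.1⟩),
      f c ⟨b, hb⟩ x = f d ⟨b, hb⟩ y ↔ f c d x = y := by
    intro c d x y
    rw [← hf_comp c d ⟨b, hb⟩ x, (f d ⟨b, hb⟩).injective.eq_iff]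
  -- Links the `Σ₁` definition of relations with `F`: the tuples `z p` are the representatives in
  -- `D(u)` of the classes of the `xs p`. Left general in `P`, to serve positive and negative
  -- relations alike.
  have hrow : ∀ (R : Σ n, L'.Relations n) (P : GenSigmaOne L (R.1 + 1)) (xs : Fin R.1 → Tuple B),
      (∃ (u : Tuple B) (z : Fin R.1 → Tuple B), (fixedLength φ).Holds ![u] ∧
          P.Holds (Fin.cons (α := fun _ => Tuple B) u z) ∧
          (∀ p, (fixedLength φ).Holds ![tupleTake l (xs p)]) ∧
          ∀ p, ψ.Holds ![tupleTake l (xs p), u, tupleDrop l (xs p), z p]) ↔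
        ∃ (h : ∀ p, xs p ∈ D) (u : autOrbit L b) (y : Fin R.1 → S.Domain ⟨l, u.1⟩),
          (∀ p, F ⟨xs p, h p⟩ = f u ⟨b, hb⟩ (y p)) ∧
          P.Holds (Fin.cons (α := fun _ => Tuple B) ⟨l, u.1⟩ fun p => (y p : Tuple B)) := by
    intro R P xs
    simp only [horb]
    constructor
    · rintro ⟨_, z, ⟨u, rfl⟩, hP, hc, hz⟩
      choose c hc using hc
      simp only [hc, hψ_graph] at hz
      choose hx hz using hz
      obtain rfl : (fun p => (f (c p) u ⟨_, hx p⟩ : Tuple B)) = z := funext hz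
      refine ⟨fun p => ⟨c p, hc p, hx p⟩, u, fun p => f (c p) u ⟨_, hx p⟩, fun p => ?_, hP⟩
      obtain ⟨_, h⟩ := hF ⟨xs p, ⟨c p, hc p, hx p⟩⟩ (c p) (hc p)
      exact h.trans (hf_comp _ _ _ _).symm
    · rintro ⟨h, u, y, hy, hP⟩
      refine ⟨_, _, ⟨u, rfl⟩, hP, fun p => ⟨_, hpar ⟨_, h p⟩⟩, fun p => ?_⟩
      rw [hpar ⟨_, h p⟩, hψ_graph]
      exact ⟨helt ⟨_, h p⟩, congrArg Subtype.val ((hiso _ _ _ _).1 (hy p))⟩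
  refine ⟨D, s, pre, ?_, ?_, ?_, ?_, ?_, ?_⟩
  · obtain ⟨e⟩ := hS.2
    -- The relations on `D` are pulled back along `F`, so this bijection is automatically an
    -- isomorphism.
    let q : Quotient s ≃ S.Domain ⟨l, b⟩ := Setoid.quotientKerEquivOfSurjective F hFsurj
    refine ⟨(Language.Equiv.symm ⟨q, fun g => isEmptyElim g, fun {n} R x => ?_⟩).comp e⟩
    obtain ⟨y, rfl⟩ : ∃ y : Fin n → D, x = fun p => Quotient.mk s (y p) :=
      ⟨fun p => (x p).out, funext fun p => (x p).out_eq.symm⟩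
    exact (Language.relMap_quotient_mk' s R y).symm
  · obtain ⟨G, hG, hG'⟩ := exists_isComputable_dom (B := B) hφ S.dom_computable hψ
    exact ⟨G, hG, fun x => (hG' x).trans (hφx x).symm⟩
  · obtain ⟨G, hG, hG'⟩ := exists_isComputable_eqv (B := B) hφ S.dom_computable hψ
    refine ⟨G, hG, fun x y => (hG' x y).trans ?_⟩
    simp only [horb]
    constructor
    · rintro ⟨⟨c, hc⟩, ⟨d, hd⟩, h⟩
      rw [hc, hd, hψ_graph] at h
      obtain ⟨hx, h⟩ := h
      have hy : tupleDrop l y ∈ S.Domain ⟨l, d.1⟩ := h ▸ Subtype.prop _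
      have hxD : x ∈ D := ⟨c, hc, hx⟩
      have hyD : y ∈ D := ⟨d, hd, hy⟩
      refine ⟨hxD, hyD, ?_⟩
      obtain ⟨_, h1⟩ := hF ⟨x, hxD⟩ c hc
      obtain ⟨_, h2⟩ := hF ⟨y, hyD⟩ d hd
      exact h1.trans (((hiso c d _ _).2 (Subtype.ext h)).trans h2.symm)
    · rintro ⟨hxD, hyD, h⟩
      obtain ⟨c, hc, hx⟩ := id hxD
      obtain ⟨d, hd, hy⟩ := id hyD
      refine ⟨⟨c, hc⟩, ⟨d, hd⟩, ?_⟩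
      rw [hc, hd, hψ_graph]
      obtain ⟨_, h1⟩ := hF ⟨x, hxD⟩ c hc
      obtain ⟨_, h2⟩ := hF ⟨y, hyD⟩ d hd
      exact ⟨hx, congrArg Subtype.val ((hiso c d _ _).1 (h1.symm.trans (h.trans h2)))⟩
  · obtain ⟨G, hG, hG'⟩ := exists_isComputable_neqv (B := B) hφ S.dom_computable hψ
    refine ⟨G, hG, fun x y => (hG' x y).trans ?_⟩
    simp only [horb]
    constructor
    · rintro ⟨z, ⟨c, hc⟩, ⟨d, hd⟩, h, hy, hz⟩
      rw [hc, hd, hψ_graph] at h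
      rw [hd] at hy
      obtain ⟨hx, rfl⟩ := h
      have hxD : x ∈ D := ⟨c, hc, hx⟩
      have hyD : y ∈ D := ⟨d, hd, hy⟩
      refine ⟨hxD, hyD, fun h => hz ?_⟩
      obtain ⟨_, h1⟩ := hF ⟨x, hxD⟩ c hc
      obtain ⟨_, h2⟩ := hF ⟨y, hyD⟩ d hd
      exact congrArg Subtype.val ((hiso c d _ _).1 (h1.symm.trans (Eq.trans h h2)))
    · rintro ⟨hxD, hyD, h⟩
      obtain ⟨c, hc, hx⟩ := id hxD
      obtain ⟨d, hd, hy⟩ := id hyD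
      refine ⟨f c d ⟨_, hx⟩, ⟨c, hc⟩, ⟨d, hd⟩, ?_, ?_, fun hz => h ?_⟩
      · rw [hc, hd, hψ_graph]
        exact ⟨hx, rfl⟩
      · rw [hd]
        exact hy
      · obtain ⟨_, h1⟩ := hF ⟨x, hxD⟩ c hc
        obtain ⟨_, h2⟩ := hF ⟨y, hyD⟩ d hd
        exact h1.trans (((hiso c d _ _).2 (Subtype.ext hz)).trans h2.symm)
  · obtain ⟨G, hG, hG'⟩ := exists_isComputableSeq_rel (B := B) hφ S.dom_computable hψ
      S.pos_computable
    refine ⟨G, hG, fun R xs => (hG' R xs).trans ((hrow R _ xs).trans ?_)⟩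
    refine exists_congr fun h => ?_
    constructor
    · rintro ⟨u, y, hy, hP⟩
      exact (hrel R _ u y hy).2 hP
    · intro hR
      -- For the converse take `u = b`, with the values of `F` themselves as representatives.
      have hy := fun p => (hf_id ⟨b, hb⟩ (F ⟨xs p, h p⟩)).symm
      exact ⟨⟨b, hb⟩, _, hy, (hrel R _ ⟨b, hb⟩ _ hy).1 hR⟩
  · obtain ⟨G, hG, hG'⟩ := exists_isComputableSeq_rel (B := B) hφ S.dom_computable hψ
      S.neg_computable
    refine ⟨G, hG, fun R xs => (hG' R xs).trans ((hrow R _ xs).trans ?_)⟩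
    refine exists_congr fun h => ?_
    constructor
    · rintro ⟨u, y, hy, hP⟩ hR
      -- The witness `u` is arbitrary in the orbit, so complementarity is needed at `u` and not only
      -- at `b`.
      exact ((hS.of_mem_autOrbit u.2 R _).2.1 hP).2 ((hrel R _ u y hy).1 hR)
    · intro hR
      have hy := fun p => (hf_id ⟨b, hb⟩ (F ⟨xs p, h p⟩)).symm
      exact ⟨⟨b, hb⟩, _, hy, (hS.of_mem_autOrbit hb R _).2.2
        ⟨fun p => Subtype.prop _, fun h' => hR ((hrel R _ ⟨b, hb⟩ _ hy).2 h')⟩⟩
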